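/- For every sample size $n$, let $p_n, k_n$ be natural numbers, $\beta_n \in \mathbb{R}^{p_n}$ and $\Sigma_n \in \mathbb{R}^{p_n \times p_n}$ positive semidefinite, and let $\sigma > 0$ and $\alpha \in (0,1)$ be fixed. Consider the linear model $y = X\beta_n + \sigma z$, where the rows of $X \in \mathbb{R}^{n \times p_n}$ are independent with the centred Gaussian distribution $\mathcal{N}(0, \Sigma_n)$, and $z \sim \mathcal{N}(0, I_n)$ is independent of $X$. For a matrix $S \in \mathbb{R}^{p_n \times k_n}$ put $\hat\beta^S = (S^\top X^\top X S)^{-1} S^\top X^\top y$ and $$F_n(S) = \frac{y^\top X S \hat\beta^S / k_n}{\|y - X S \hat\beta^S\|_2^2/(n-k_n)}, \qquad \Psi_n(S) = \mathbb{P}\bigl(F_n(S) > q_{\alpha, k_n, n-k_n}\bigr), \qquad \Delta_n^2(S) = \beta_n^\top \Sigma_n S (S^\top \Sigma_n S)^{-1} S^\top \Sigma_n \beta_n,$$ where $q_{\alpha,a,b}$ is the upper $\alpha$ quantile of the $F$-distribution with $(a,b)$ degrees of freedom, and the probability is over $(X,z)$ with $S$ held fixed. Let $\Phi$ and $z_\alpha$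 be the distribution function and the upper $\alpha$ quantile of $\mathcal{N}(0,1)$. Assume that, as $n \to \infty$, $\beta_n^\top \Sigma_n \beta_n \to 0$ and $k_n/n \to \rho \in (0,1)$, and that $k_n < \operatorname{rank}(\Sigma_n)$ for all sufficiently large $n$. For every $n$ let $S_n \in \mathbb{R}^{p_n \times k_n}$ be a random matrix with i.i.d. $\mathcal{N}(0,1)$ entries, all defined on one probability space, with an arbitrary joint distribution across $n$. Then, for almost every realization of the sequence $(S_n)_n$, $$\Psi_n(S_n) - \Phi\left(-z_\alpha + \sqrt{\frac{(1-\rho)n}{2\rho}}\,\frac{\Delta_n^2(S_n)}{\sigma^2}\right) \longrightarrow 0 \qquad (n \to \infty).$$ -/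

import Mathlib

open MeasureTheory ProbabilityTheory Filter Topology
open scoped Matrix

noncomputable section

namespace SketchedFTest

/-- The standard normal distribution function `Φ`. -/
def stdNormalCDF (x : ℝ) : ℝ := cdf (gaussianReal 0 1) x

/-- The upper `α` quantile of a probability measure on `ℝ`: the least `x` with
`μ (x, ∞) ≤ α`. -/
def upperQuantile (μ : Measure ℝ) (α : ℝ) : ℝ :=
  sInf {x : ℝ | μ.real (Set.Ioi x) ≤ α}

/-- `z_α`, the upper `α` quantile of `N(0, 1)`. -/
def zQuantile (α : ℝ) : ℝ := upperQuantile (gaussianReal 0 1) α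

/-- The chi-squared distribution with `d` degrees of freedom: the law of the sum of the squares
of `d` independent standard normal variables. -/
def chiSquared (d : ℕ) : Measure ℝ :=
  (Measure.pi fun _ : Fin d => gaussianReal 0 1).map fun x => ∑ i, x i ^ 2

/-- The (central) `F`-distribution with `(a, b)` degrees of freedom: the law of
`(U / a) / (V / b)` for independent `U ∼ χ²_a` and `V ∼ χ²_b`. -/
def fDist (a b : ℕ) : Measure ℝ :=
  ((chiSquared a).prod (chiSquared b)).map fun w => (w.1 / a) / (w.2 / b)

/-- `q_{α, a, b}`, the upper `α` quantile of the `F`-distribution with `(a, b)` degrees of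
freedom. -/
def fQuantile (α : ℝ) (a b : ℕ) : ℝ := upperQuantile (fDist a b) α

/-- The least squares estimate of the response `y` on the sketched design `X S`,
`(Sᵀ Xᵀ X S)⁻¹ Sᵀ Xᵀ y`. -/
def sketchedLSE {n p k : ℕ} (X : Matrix (Fin n) (Fin p) ℝ) (y : Fin n → ℝ)
    (S : Matrix (Fin p) (Fin k) ℝ) : Fin k → ℝ :=
  ((Sᵀ * Xᵀ * X * S)⁻¹ * Sᵀ * Xᵀ) *ᵥ y

/-- The residual `y - X S b` of the sketched regression, `b` the least squares estimate. -/
def sketchedResidual {n p k : ℕ} (X : Matrix (Fin n) (Fin p) ℝ) (y : Fin n → ℝ)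
    (S : Matrix (Fin p) (Fin k) ℝ) : Fin n → ℝ :=
  y - (X * S) *ᵥ sketchedLSE X y S

/-- The sketched `F`-test statistic
`F(S) = (yᵀ X S b / k) / (‖y - X S b‖₂² / (n - k))`, `b` the least squares estimate. -/
def sketchedF {n p k : ℕ} (X : Matrix (Fin n) (Fin p) ℝ) (y : Fin n → ℝ)
    (S : Matrix (Fin p) (Fin k) ℝ) : ℝ :=
  ((y ⬝ᵥ ((X * S) *ᵥ sketchedLSE X y S)) / k) /
    ((∑ i, sketchedResidual X y S i ^ 2) / ((n : ℝ) - k))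

/-- The matrix with rows `x 0, …, x (n - 1)`. -/
def designMatrix {n p : ℕ} (x : Fin n → EuclideanSpace ℝ (Fin p)) : Matrix (Fin n) (Fin p) ℝ :=
  Matrix.of fun i j => x i j

/-- The response `y = X β + σ z` of the linear model with design rows `x`. -/
def response {n p : ℕ} (x : Fin n → EuclideanSpace ℝ (Fin p)) (β : Fin p → ℝ) (σ : ℝ)
    (z : EuclideanSpace ℝ (Fin n)) : Fin n → ℝ :=
  fun i => (designMatrix x *ᵥ β) i + σ * z i

/-- The rows of the random design are independent, each with the centred Gaussian law
`N(0, C)`. -/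
structure IsGaussianDesign {Ω : Type*} [MeasurableSpace Ω] (P : Measure Ω) {n p : ℕ}
    (x : Ω → Fin n → EuclideanSpace ℝ (Fin p)) (C : Matrix (Fin p) (Fin p) ℝ) : Prop where
  indep : iIndepFun (fun i ω => x ω i) P
  law : ∀ i, HasLaw (fun ω => x ω i) (multivariateGaussian 0 C) P

/-- A Gaussian sketching matrix: a random `p × k` matrix with i.i.d. `N(0, 1)` entries. -/
structure IsGaussianSketch {Ω : Type*} [MeasurableSpace Ω] (Q : Measure Ω) {p k : ℕ}
    (S : Ω → Matrix (Fin p) (Fin k) ℝ) : Prop where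
  indep : iIndepFun (fun (ij : Fin p × Fin k) ω => S ω ij.1 ij.2) Q
  law : ∀ i j, HasLaw (fun ω => S ω i j) (gaussianReal 0 1) Q

/-- The power function `S ↦ P(F(S) > q_{α, k, n - k})` of the level `α` sketched `F`-test, at a
fixed sketching matrix `S`; the probability is over the design and the noise. -/
def sketchedPower {Ω : Type*} [MeasurableSpace Ω] (P : Measure Ω) {n p k : ℕ}
    (x : Ω → Fin n → EuclideanSpace ℝ (Fin p)) (z : Ω → EuclideanSpace ℝ (Fin n))
    (β : Fin p → ℝ) (σ α : ℝ) (S : Matrix (Fin p) (Fin k) ℝ) : ℝ :=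
  P.real {ω | fQuantile α k (n - k) <
    sketchedF (designMatrix (x ω)) (response (x ω) β σ (z ω)) S}

/-- `Δ² = βᵀ C S (Sᵀ C S)⁻¹ Sᵀ C β`, for the covariance matrix `C`. -/
def deltaSq {p k : ℕ} (C : Matrix (Fin p) (Fin p) ℝ) (β : Fin p → ℝ)
    (S : Matrix (Fin p) (Fin k) ℝ) : ℝ :=
  β ⬝ᵥ ((C * S * (Sᵀ * C * S)⁻¹ * Sᵀ * C) *ᵥ β)

end SketchedFTest

end

open MeasureTheory ProbabilityTheory Filter Topology
open scoped Matrix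

/-! Fix a sketch `S` with `Sᵀ C S` invertible, and regress the population signal `xᵀβ` on the
sketched covariates `Sᵀx`: the coefficient is `γ = (Sᵀ C S)⁻¹ Sᵀ C β`, and the residual direction `v
= β - S γ` satisfies `Sᵀ C v = 0`. For Gaussian rows uncorrelated means independent, so `y = X S γ +
s e` is a correctly specified linear model: `e` is a standard Gaussian vector independent of `X S`,
with `s² = vᵀ C v + σ² = βᵀ C β - Δ² + σ²`. What the sketch misses only inflates the noise.

Conditioning on `X S` then gives the exact representation of `exists_sketchedF_decomposition`, `F =
((U + 2T + D M) / k) / (V / (n - k))`, where `D = Δ² / s²`, `U` and `V` are independent chi-squared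
variables with `k` and `n - k` degrees of freedom, `M` is chi-squared with `n`, and the cross term
`T` has second moment at most `n D`. Since `Δ² ≤ βᵀ C β → 0`, also `D → 0` and `s² → σ²`.

At the scale `c = √(n ρ (1 - ρ) / 2)` the central limit theorem makes `c (U / k - V / (n - k))`
asymptotically standard normal. The same limit without signal gives `c (q - 1) → z_α` for the F
quantile `q` (`tendsto_fQuantile`). The cross term is negligible, and `D M / k` contributes a drift
asymptotic to `√((1 - ρ) n / (2ρ)) Δ² / σ²`. This drift may be unbounded, so its error is controlled
only relatively; `TailsTendsto.tendsto_drift` handles bounded and divergent drifts together.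

Almost every sketch is admissible because `det (Sᵀ C S)` is a polynomial in Gaussian entries that is
not identically zero when `k ≤ rank C`. -/

namespace SketchedFTest

/-! ### Tail and quantile of the standard normal law -/

/-- The upper tail `t ↦ P(Z > t)` of the standard normal distribution. -/
noncomputable def gTail (t : ℝ) : ℝ := (gaussianReal 0 1).real (Set.Ioi t)

instance nullSingletonClass_stdGaussianReal : NullSingletonClass (gaussianReal 0 1) :=
  nullSingletonClass_gaussianReal one_ne_zero

lemma gTail_eq_one_sub_cdf (t : ℝ) : gTail t = 1 - cdf (gaussianReal 0 1) t := by
  rw [gTail, ← Set.compl_Iic, probReal_compl_eq_one_sub measurableSet_Iic, cdf_eq_real]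

lemma stdNormalCDF_neg (t : ℝ) : stdNormalCDF (-t) = gTail t := by
  have h : (gaussianReal 0 1).real (Set.Iic (-t)) = (gaussianReal 0 1).real (Set.Ici t) := by
    conv_lhs => rw [← neg_zero, ← gaussianReal_map_neg]
    rw [map_measureReal_apply (by fun_prop) measurableSet_Iic]
    congr 1
    ext x
    simp
  rw [stdNormalCDF, cdf_eq_real, h, gTail]
  exact measureReal_congr Ioi_ae_eq_Ici.symm

/-- A distribution function is right-continuous, and its jump at `t` is the mass of `{t}`, which is
zero for the normal law. -/
lemma continuous_gTail : Continuous gTail := by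
  have : gTail = fun t => 1 - cdf (gaussianReal 0 1) t := funext gTail_eq_one_sub_cdf
  rw [this]
  refine continuous_const.sub (continuous_iff_continuousAt.2 fun t => ?_)
  rw [(cdf (gaussianReal 0 1)).mono.continuousAt_iff_leftLim_eq_rightLim,
    StieltjesFunction.rightLim_eq]
  have h := (cdf (gaussianReal 0 1)).measure_singleton t
  rw [measure_cdf, measure_singleton, eq_comm, ENNReal.ofReal_eq_zero] at h
  exact le_antisymm ((cdf (gaussianReal 0 1)).mono.leftLim_le le_rfl) (by linarith)

lemma strictAnti_gTail : StrictAnti gTail := by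
  intro a b hab
  have hpos : 0 < (gaussianReal 0 1).real (Set.Ioc a b) := by
    rw [measureReal_def, ENNReal.toReal_pos_iff]
    refine ⟨pos_iff_ne_zero.2 fun h => ?_, measure_lt_top _ _⟩
    -- Lebesgue measure is absolutely continuous with respect to the Gaussian, so a Gaussian-null
    -- interval would have length zero.
    have := gaussianReal_absolutelyContinuous' 0 (one_ne_zero (α := NNReal)) h
    simp [hab.not_ge] at this
  have : gTail a = (gaussianReal 0 1).real (Set.Ioc a b) + gTail b := by
    rw [gTail, gTail, ← Set.Ioc_union_Ioi_eq_Ioi hab.le, measureReal_union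
      (Set.Ioc_disjoint_Ioi le_rfl) measurableSet_Ioi]
  linarith

lemma tendsto_gTail_atBot : Tendsto gTail atBot (𝓝 1) := by
  have : gTail = fun t => 1 - cdf (gaussianReal 0 1) t := funext gTail_eq_one_sub_cdf
  rw [this]
  simpa using (tendsto_cdf_atBot (gaussianReal 0 1)).const_sub 1

lemma tendsto_gTail_atTop : Tendsto gTail atTop (𝓝 0) := by
  have : gTail = fun t => 1 - cdf (gaussianReal 0 1) t := funext gTail_eq_one_sub_cdf
  rw [this]
  simpa using (tendsto_cdf_atTop (gaussianReal 0 1)).const_sub 1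

/-- The normal tail lies strictly above `α` to the left of the quantile. -/
lemma lt_gTail_of_lt_zQuantile {α t : ℝ} (hα : α < 1) (h : t < zQuantile α) : α < gTail t := by
  by_contra! hle
  obtain ⟨K, hK⟩ := eventually_atBot.1 (tendsto_gTail_atBot.eventually_const_lt hα)
  refine (csInf_le (s := {x | (gaussianReal 0 1).real (Set.Ioi x) ≤ α}) ⟨K, fun x hx => ?_⟩
    hle).not_gt h
  by_contra! hxK
  exact (hK x hxK.le).not_ge hx

lemma gTail_lt_of_zQuantile_lt {α t : ℝ} (hα : 0 < α) (h : zQuantile α < t) : gTail t < α := by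
  have hne : {x | (gaussianReal 0 1).real (Set.Ioi x) ≤ α}.Nonempty :=
    ((tendsto_gTail_atTop.eventually_lt_const hα).exists).imp fun x hx => hx.le
  obtain ⟨x, hx, hxt⟩ := exists_lt_of_csInf_lt hne h
  exact (strictAnti_gTail hxt).trans_le hx

/-! ### Convergence in probability, Slutsky's theorem and unbounded drifts -/

section Convergence

variable {ι : Type*} {Ω : ι → Type*} [∀ i, MeasurableSpace (Ω i)] {P : (i : ι) → Measure (Ω i)}
  {l : Filter ι}

/-- Convergence to zero in probability, for variables on varying probability spaces. -/
def TendstoInProb (P : (i : ι) → Measure (Ω i)) (X : (i : ι) → Ω i → ℝ) (l : Filter ι) : Prop :=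
  ∀ δ : ℝ, 0 < δ → Tendsto (fun i => (P i).real {ω | δ < |X i ω|}) l (𝓝 0)

/-- Pointwise convergence of the upper tails to those of the standard normal distribution. -/
def TailsTendsto (P : (i : ι) → Measure (Ω i)) (A : (i : ι) → Ω i → ℝ) (l : Filter ι) : Prop :=
  ∀ t : ℝ, Tendsto (fun i => (P i).real {ω | t < A i ω}) l (𝓝 (gTail t))

lemma tendstoInProb_of_tendsto {c : ι → ℝ} (hc : Tendsto c l (𝓝 0)) :
    TendstoInProb P (fun i _ => c i) l := by
  intro δ hδ
  refine tendsto_const_nhds.congr' ?_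
  filter_upwards [hc.abs.eventually_le_const (by simpa using hδ)] with i hi
  simp [not_lt.2 hi]

lemma TendstoInProb.mono {X : (i : ι) → Ω i → ℝ} (hX : TendstoInProb P X l) {l' : Filter ι}
    (h : l' ≤ l) : TendstoInProb P X l' := fun δ hδ => (hX δ hδ).mono_left h

lemma TailsTendsto.mono {X : (i : ι) → Ω i → ℝ} (hX : TailsTendsto P X l) {l' : Filter ι}
    (h : l' ≤ l) : TailsTendsto P X l' := fun t => (hX t).mono_left h

variable [∀ i, IsProbabilityMeasure (P i)]

lemma TendstoInProb.add {X Y : (i : ι) → Ω i → ℝ} (hX : TendstoInProb P X l)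
    (hY : TendstoInProb P Y l) : TendstoInProb P (fun i ω => X i ω + Y i ω) l := by
  intro δ hδ
  refine squeeze_zero (fun _ => measureReal_nonneg) (fun i => ?_)
    (by simpa using (hX (δ / 2) (by positivity)).add (hY (δ / 2) (by positivity)))
  refine (measureReal_mono (fun ω hω => ?_)).trans (measureReal_union_le _ _)
  by_contra h
  simp only [Set.mem_union, Set.mem_ofPred_eq, not_or, not_lt] at h hω
  linarith [abs_add_le (X i ω) (Y i ω)]

lemma TendstoInProb.mul_of_tendsto {X : (i : ι) → Ω i → ℝ} (hX : TendstoInProb P X l)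
    {c : ι → ℝ} {a : ℝ} (hc : Tendsto c l (𝓝 a)) :
    TendstoInProb P (fun i ω => c i * X i ω) l := by
  intro δ hδ
  refine squeeze_zero' (Eventually.of_forall fun _ => measureReal_nonneg) ?_
    (hX (δ / (|a| + 1)) (by positivity))
  filter_upwards [hc.abs.eventually_le_const (lt_add_one |a|)] with i hi
  refine measureReal_mono fun ω hω => ?_
  simp only [Set.mem_ofPred_eq] at hω ⊢
  rw [div_lt_iff₀ (by positivity)]
  rw [abs_mul] at hω
  nlinarith [abs_nonneg (X i ω)]

/-- The sandwich estimate behind Slutsky's theorem. -/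
lemma measureReal_gt_le_add {Ω : Type*} [MeasurableSpace Ω] (P : Measure Ω)
    [IsProbabilityMeasure P] (A B : Ω → ℝ) (s t : ℝ) :
    P.real {ω | s < A ω} ≤ P.real {ω | t < B ω} + P.real {ω | s - t < |A ω - B ω|} := by
  refine (measureReal_mono (fun ω hω => ?_)).trans (measureReal_union_le _ _)
  by_contra h
  simp only [Set.mem_union, Set.mem_ofPred_eq, not_or, not_lt] at h hω
  linarith [le_abs_self (A ω - B ω)]

/-- **Slutsky's theorem** for tails. -/
lemma TailsTendsto.of_sub {A B : (i : ι) → Ω i → ℝ} (hA : TailsTendsto P A l)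
    (h : TendstoInProb P (fun i ω => B i ω - A i ω) l) : TailsTendsto P B l := by
  intro t
  refine tendsto_order.2 ⟨fun a ha => ?_, fun a ha => ?_⟩
  · obtain ⟨δ, hδ, hlt⟩ : ∃ δ > 0, a < gTail (t + δ) := by
      have : ∀ᶠ δ in 𝓝[>] (0 : ℝ), a < gTail (t + δ) :=
        ((continuous_gTail.comp (continuous_const_add t)).tendsto' 0 (gTail t)
          (by simp)).eventually_const_lt ha |>.filter_mono nhdsWithin_le_nhds
      obtain ⟨δ, h1, h2⟩ := (this.and self_mem_nhdsWithin).exists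
      exact ⟨δ, h2, h1⟩
    have := (hA (t + δ)).sub (h δ hδ)
    filter_upwards [this.eventually_const_lt (by simpa using hlt)] with i hi
    have := measureReal_gt_le_add (P i) (A i) (B i) (t + δ) t
    simp only [add_sub_cancel_left, abs_sub_comm (A i _)] at this
    linarith
  · obtain ⟨δ, hδ, hlt⟩ : ∃ δ > 0, gTail (t - δ) < a := by
      have : ∀ᶠ δ in 𝓝[>] (0 : ℝ), gTail (t - δ) < a :=
        ((continuous_gTail.comp (continuous_sub_left t)).tendsto' 0 (gTail t)
          (by simp)).eventually_lt_const ha |>.filter_mono nhdsWithin_le_nhds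
      obtain ⟨δ, h1, h2⟩ := (this.and self_mem_nhdsWithin).exists
      exact ⟨δ, h2, h1⟩
    have := (hA (t - δ)).add (h δ hδ)
    filter_upwards [this.eventually_lt_const (by simpa using hlt)] with i hi
    have := measureReal_gt_le_add (P i) (B i) (A i) t (t - δ)
    simp only [sub_sub_cancel] at this
    linarith

/-- Tail probabilities of an asymptotically normal variable with a drift `m i ≥ 0` that need not
stay bounded. -/
theorem TailsTendsto.tendsto_drift {A r e : (i : ι) → Ω i → ℝ} (hA : TailsTendsto P A l)
    (hr : TendstoInProb P r l) (he : TendstoInProb P e l) {m : ι → ℝ} (hm : ∀ i, 0 ≤ m i) (z : ℝ) :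
    Tendsto (fun i => (P i).real {ω | z < A i ω + m i * (1 + r i ω) + e i ω} - gTail (z - m i))
      l (𝓝 0) := by
  -- Along an ultrafilter the drift has a limit in the compact space `EReal`, so a possibly
  -- oscillating `m` splits into a finite and an infinite case.
  refine tendsto_iff_ultrafilter _ _ _ |>.2 fun U hU => ?_
  replace hA := hA.mono hU
  replace hr := hr.mono hU
  replace he := he.mono hU
  obtain ⟨M, -, hM⟩ := isCompact_univ.ultrafilter_le_nhds (U.map fun i => (m i : EReal)) (by simp)
  replace hM : Tendsto (fun i => (m i : EReal)) U (𝓝 M) := hM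
  induction M with
  | bot =>
    have := ge_of_tendsto' hM (fun i => EReal.coe_nonneg.2 (hm i))
    simp at this
  | coe M =>
    rw [EReal.tendsto_coe] at hM
    -- With a finite limit `M`, the quantity `m r + e + (m - M)` vanishes in probability, and
    -- Slutsky's theorem applies.
    have h1 : TailsTendsto P (fun i ω => A i ω + m i * (1 + r i ω) + e i ω - M) U := by
      refine hA.of_sub ?_
      have := ((hr.mul_of_tendsto hM).add he).add
        (tendstoInProb_of_tendsto (by simpa using hM.sub_const M))
      convert this using 3
      ring
    have h2 := (h1 (z - M)).sub ((continuous_gTail.tendsto (z - M)).comp (hM.const_sub z))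
    simp only [sub_lt_sub_iff_right, sub_self] at h2
    exact h2
  | top =>
    have hM' : Tendsto m U atTop := EReal.tendsto_coe_nhds_top_iff.1 hM
    have h2 : Tendsto (fun i => gTail (z - m i)) U (𝓝 1) :=
      tendsto_gTail_atBot.comp (tendsto_atBot_add_const_left _ z (tendsto_neg_atTop_atBot.comp hM'))
    have h1 : Tendsto (fun i => (P i).real {ω | z < A i ω + m i * (1 + r i ω) + e i ω}) U
        (𝓝 1) := by
      refine tendsto_order.2 ⟨fun a ha => ?_, fun a ha =>
        Eventually.of_forall fun i => measureReal_le_one.trans_lt ha⟩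
      obtain ⟨K, hK⟩ := (tendsto_gTail_atBot.eventually_const_lt ha).exists
      have h3 := ((hA K).sub (hr (1 / 2) (by norm_num))).sub (he 1 one_pos)
      -- Where `|r| ≤ 1/2`, `|e| ≤ 1` and `A > K`, the sum exceeds `K + m/2 - 1`, which is at least
      -- `z` once `m ≥ 2(z + 1 - K)`.
      filter_upwards [h3.eventually_const_lt (by simpa using hK),
        hM'.eventually_ge_atTop (2 * (z + 1 - K))] with i hi hmi
      have : (P i).real {ω | K < A i ω} ≤
          (P i).real {ω | z < A i ω + m i * (1 + r i ω) + e i ω} +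
            (P i).real {ω | 1 / 2 < |r i ω|} + (P i).real {ω | 1 < |e i ω|} := by
        refine (measureReal_mono (fun ω hω => ?_)).trans ((measureReal_union_le _ _).trans
          (add_le_add_left (measureReal_union_le _ _) _))
        by_contra h
        simp only [Set.mem_union, Set.mem_ofPred_eq, not_or, not_lt] at h hω
        obtain ⟨⟨h4, h5⟩, h6⟩ := h
        have h7 := (abs_le.1 h5).1
        have h8 := (abs_le.1 h6).1
        nlinarith [hm i]
      linarith
    simpa using h1.sub h2

end Convergence

/-! ### Moments and limit theorems for chi-squared variables -/

lemma measurable_sum_sq {ι : Type*} [Fintype ι] : Measurable fun x : ι → ℝ => ∑ i, x i ^ 2 := by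
  fun_prop

instance isProbabilityMeasure_chiSquared (d : ℕ) : IsProbabilityMeasure (chiSquared d) :=
  Measure.isProbabilityMeasure_map measurable_sum_sq.aemeasurable

/-- By symmetry the moment is twice a half-line integral, which is a Gamma integral with value
governed by `Γ(5/2) = (3/4)√π`. It fixes the variance 2 of a squared normal. -/
lemma integral_pow_four_gaussianReal : ∫ x, x ^ 4 ∂(gaussianReal 0 1) = 3 := by
  have hΓ : Real.Gamma (5 / 2) = 3 / 4 * √Real.pi := by
    rw [show (5 / 2 : ℝ) = 1 / 2 + 1 + 1 by norm_num, Real.Gamma_add_one (by norm_num),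
      Real.Gamma_add_one (by norm_num), Real.Gamma_one_half_eq]
    ring
  have h := integral_rpow_mul_exp_neg_mul_rpow (p := 2) (q := 4) (b := 1 / 2) two_pos
    (by norm_num) (by norm_num)
  have h2 : ((1 / 2 : ℝ) ^ (-(4 + 1) / 2 : ℝ)) = 4 * √2 := by
    rw [one_div, Real.inv_rpow two_pos.le, ← Real.rpow_neg two_pos.le, Real.sqrt_eq_rpow,
      show (-(-(4 + 1) / 2) : ℝ) = 2 + 1 / 2 by norm_num, Real.rpow_add two_pos]
    norm_num
  rw [show ((4 : ℝ) + 1) / 2 = 5 / 2 by norm_num, hΓ, h2] at h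
  have h3 := integral_comp_abs (f := fun x : ℝ => x ^ 4 * Real.exp (-(1 / 2) * x ^ 2))
  have h4 : ∫ x in Set.Ioi (0 : ℝ), x ^ 4 * Real.exp (-(1 / 2) * x ^ 2) =
      4 * √2 * (1 / 2) * (3 / 4 * √Real.pi) := by
    rw [← h]
    refine integral_congr_ae (ae_of_all _ fun x => ?_)
    norm_cast
  rw [h4] at h3
  rw [integral_gaussianReal_eq_integral_smul one_ne_zero]
  have h5 : ∀ x : ℝ, gaussianPDFReal 0 1 x • x ^ 4 =
      (√(2 * Real.pi))⁻¹ * (|x| ^ 4 * Real.exp (-(1 / 2) * |x| ^ 2)) := by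
    intro x
    simp [gaussianPDFReal, show |x| ^ 4 = x ^ 4 from Even.pow_abs (by decide) x]
    ring_nf
  simp_rw [h5]
  rw [integral_const_mul, h3, Real.sqrt_mul two_pos.le]
  have := Real.pi_pos
  field_simp

lemma integral_sq_gaussianReal : ∫ x, x ^ 2 ∂(gaussianReal 0 1) = 1 := by
  have h := variance_fun_id_gaussianReal (μ := 0) (v := 1)
  rw [variance_eq_integral (by fun_prop)] at h
  simpa using h

lemma integrable_pow_gaussianReal (m : ℕ) : Integrable (fun x => x ^ m) (gaussianReal 0 1) := by
  have := (memLp_id_gaussianReal (μ := 0) (v := 1) m).integrable_norm_pow'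
  refine (this.mono' (by fun_prop) (ae_of_all _ fun x => ?_))
  simp

lemma memLp_sq_gaussianReal : MemLp (fun x => x ^ 2) 2 (gaussianReal 0 1) := by
  rw [memLp_two_iff_integrable_sq (by fun_prop)]
  simpa [← pow_mul] using integrable_pow_gaussianReal 4

lemma variance_sq_gaussianReal : Var[fun x => x ^ 2; gaussianReal 0 1] = 2 := by
  rw [variance_eq_sub memLp_sq_gaussianReal]
  norm_num [← pow_mul, integral_sq_gaussianReal, integral_pow_four_gaussianReal]

lemma integral_id_chiSquared (d : ℕ) : ∫ x, x ∂(chiSquared d) = d := by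
  rw [chiSquared, integral_map measurable_sum_sq.aemeasurable (by fun_prop),
    integral_finsetSum]
  · simp [integral_comp_eval (μ := fun _ : Fin d => gaussianReal 0 1) (f := fun x : ℝ => x ^ 2)
      (by fun_prop), integral_sq_gaussianReal]
  · exact fun i _ => integrable_comp_eval (μ := fun _ : Fin d => gaussianReal 0 1) (i := i)
      (f := fun x : ℝ => x ^ 2) (integrable_pow_gaussianReal 2)

lemma memLp_id_chiSquared (d : ℕ) : MemLp (fun x => x) 2 (chiSquared d) := by
  rw [chiSquared, memLp_map_measure_iff (by fun_prop) measurable_sum_sq.aemeasurable]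
  refine memLp_finsetSum (f := fun i (x : Fin d → ℝ) => x i ^ 2) _ fun i _ => ?_
  exact memLp_sq_gaussianReal.comp_measurePreserving
    (measurePreserving_eval (fun _ : Fin d => gaussianReal 0 1) i)

lemma variance_id_chiSquared (d : ℕ) : Var[fun x => x; chiSquared d] = 2 * d := by
  rw [chiSquared, variance_map (by fun_prop) measurable_sum_sq.aemeasurable]
  have := variance_sum_pi (μ := fun _ : Fin d => gaussianReal 0 1) (X := fun _ x => x ^ 2)
    (fun _ => memLp_sq_gaussianReal)
  simp only [variance_sq_gaussianReal, Finset.sum_const, Finset.card_univ, Fintype.card_fin,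
    nsmul_eq_mul] at this
  rw [mul_comm, ← this]
  congr 1
  ext x
  simp

/-- Chebyshev's inequality for the chi-squared distribution. -/
lemma chiSquared_chebyshev (d : ℕ) {δ : ℝ} (hδ : 0 < δ) :
    (chiSquared d).real {x | δ < |x - d|} ≤ 2 * d / δ ^ 2 := by
  have h := meas_ge_le_variance_div_sq (memLp_id_chiSquared d) hδ
  rw [variance_id_chiSquared, integral_id_chiSquared] at h
  refine ENNReal.toReal_le_of_le_ofReal (by positivity) ((measure_mono fun x hx => ?_).trans h)
  simp only [Set.mem_ofPred_eq] at hx ⊢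
  exact hx.le

lemma tendstoInProb_chiSquared_div {ι : Type*} {l : Filter ι} {Ω : ι → Type*}
    [∀ i, MeasurableSpace (Ω i)] {P : (i : ι) → Measure (Ω i)}
    [∀ i, IsProbabilityMeasure (P i)] {U : (i : ι) → Ω i → ℝ} {d : ι → ℕ}
    (hU : ∀ᶠ i in l, HasLaw (U i) (chiSquared (d i)) (P i)) (hd : Tendsto d l atTop) :
    TendstoInProb P (fun i ω => U i ω / d i - 1) l := by
  intro δ hδ
  have h0 : Tendsto (fun i => 2 / δ ^ 2 * (d i : ℝ)⁻¹) l (𝓝 0) := by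
    have := (tendsto_inv_atTop_zero (𝕜 := ℝ).comp
      (tendsto_natCast_atTop_atTop.comp hd)).const_mul (2 / δ ^ 2)
    rwa [mul_zero] at this
  refine squeeze_zero' (Eventually.of_forall fun _ => measureReal_nonneg) ?_ h0
  filter_upwards [hU, hd.eventually_ge_atTop 1] with i hi hdi
  have hd0 : (0 : ℝ) < d i := by exact_mod_cast hdi
  have h := chiSquared_chebyshev (d i) (mul_pos hδ hd0)
  have hm : MeasurableSet {x : ℝ | δ * d i < |x - d i|} := measurableSet_lt (by fun_prop) (by fun_prop)
  rw [← hi.measureReal_eq hm] at h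
  refine (measureReal_mono fun ω hω => ?_).trans (h.trans_eq ?_)
  · simp only [Set.mem_ofPred_eq] at hω ⊢
    rwa [div_sub_one hd0.ne', abs_div, abs_of_pos hd0, lt_div_iff₀ hd0] at hω
  · field_simp

/-- The centred and scaled chi-squared distribution has characteristic function tending to that of
the standard normal distribution. -/
lemma tendsto_charFun_chiSquared (t : ℝ) :
    Tendsto (fun d : ℕ => charFun ((chiSquared d).map fun x => (x - d) / √(2 * d)) t) atTop
      (𝓝 (Complex.exp (-t ^ 2 / 2))) := by
  -- The classical central limit theorem is applied to `(x² - 1)/√2`, the standardised square of one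
  -- normal variable.
  have h := tendsto_charFun_inv_sqrt_mul_pow (P := gaussianReal 0 1)
    (X := fun x => (x ^ 2 - 1) / √2) (by fun_prop) ?_ ?_ t
  · refine h.congr fun d => ?_
    have hprob : IsProbabilityMeasure ((gaussianReal 0 1).map fun x => (x ^ 2 - 1) / √2) :=
      Measure.isProbabilityMeasure_map (by fun_prop)
    have h1 := charFun_map_sum_pi_eq_prod
      (μ := fun _ : Fin d => (gaussianReal 0 1).map fun x => (x ^ 2 - 1) / √2)
    have h2 : (chiSquared d).map (fun x => (x - d) / √(2 * d)) =
      ((Measure.pi fun _ : Fin d => (gaussianReal 0 1).map fun x => (x ^ 2 - 1) / √2).map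
        (fun x => ∑ i, x i)).map ((√d)⁻¹ * ·) := by
      rw [← Measure.pi_map_pi (by fun_prop), Measure.map_map (by fun_prop) (by fun_prop),
        Measure.map_map (by fun_prop) (by fun_prop), chiSquared,
        Measure.map_map (by fun_prop) (by fun_prop)]
      congr 1
      ext x
      simp [← Finset.sum_div, Finset.sum_sub_distrib]
      ring
    rw [h2, charFun_map_mul, h1]
    simp
  · rw [integral_div, integral_sub (integrable_pow_gaussianReal 2) (by simp)]
    simp [integral_sq_gaussianReal]
  · have := variance_eq_integral (μ := gaussianReal 0 1) (X := fun x => x ^ 2) (by fun_prop)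
    rw [variance_sq_gaussianReal, integral_sq_gaussianReal] at this
    simp only [Pi.pow_apply, div_pow]
    rw [integral_div, ← this]
    simp

/-- The central limit theorem for differences of independent chi-squared variables. -/
lemma tailsTendsto_chiSquared_sub {Ω : ℕ → Type*}
    [∀ i, MeasurableSpace (Ω i)] {P : (i : ℕ) → Measure (Ω i)} [∀ i, IsProbabilityMeasure (P i)]
    {U V : (i : ℕ) → Ω i → ℝ} {d e : ℕ → ℕ}
    (hUV : ∀ᶠ i in atTop,
      HasLaw (fun ω => (U i ω, V i ω)) ((chiSquared (d i)).prod (chiSquared (e i))) (P i))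
    (hd : Tendsto d atTop atTop) (he : Tendsto e atTop atTop) {a b : ℝ} (hab : a ^ 2 + b ^ 2 = 1) :
    TailsTendsto P (fun i ω => a * ((U i ω - d i) / √(2 * d i)) -
      b * ((V i ω - e i) / √(2 * e i))) atTop := by
  set μ : ℕ → Measure ℝ := fun i => ((chiSquared (d i)).prod (chiSquared (e i))).map
    fun w => a * ((w.1 - d i) / √(2 * d i)) - b * ((w.2 - e i) / √(2 * e i)) with hμ
  have hprob : ∀ i, IsProbabilityMeasure (μ i) := fun i =>
    Measure.isProbabilityMeasure_map (by fun_prop)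
  have hchar : ∀ i t, charFun (μ i) t =
      charFun ((chiSquared (d i)).map fun x => (x - d i) / √(2 * d i)) (a * t) *
      charFun ((chiSquared (e i)).map fun x => (x - e i) / √(2 * e i)) (-b * t) := by
    intro i t
    have h1 : IsProbabilityMeasure ((chiSquared (d i)).map fun x => a * ((x - d i) / √(2 * d i))) :=
      Measure.isProbabilityMeasure_map (by fun_prop)
    have h2 : IsProbabilityMeasure
        ((chiSquared (e i)).map fun x => -b * ((x - e i) / √(2 * e i))) :=
      Measure.isProbabilityMeasure_map (by fun_prop)
    have h3 : μ i = (((chiSquared (d i)).map fun x => a * ((x - d i) / √(2 * d i))).prod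
        ((chiSquared (e i)).map fun x => -b * ((x - e i) / √(2 * e i)))).map
        fun w => w.1 + w.2 := by
      rw [Measure.map_prod_map _ _ (by fun_prop) (by fun_prop),
        Measure.map_map (by fun_prop) (by fun_prop)]
      refine congrArg (fun f => Measure.map f _) (funext fun w => ?_)
      simp only [Function.comp_apply, Prod.map_fst, Prod.map_snd]
      ring
    rw [h3, charFun_map_add_prod_eq_mul, Pi.mul_apply, ← charFun_map_mul, ← charFun_map_mul,
      Measure.map_map (by fun_prop) (by fun_prop), Measure.map_map (by fun_prop) (by fun_prop)]
    rfl
  -- Lévy's continuity theorem: the two factors tend to `exp(-(at)²/2)` and `exp(-(bt)²/2)`, whose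
  -- product is the normal one because `a² + b² = 1`.
  have hlim : Tendsto (β := ProbabilityMeasure ℝ) (fun i => ⟨μ i, hprob i⟩) atTop
      (𝓝 ⟨gaussianReal 0 1, inferInstance⟩) := by
    refine ProbabilityMeasure.tendsto_iff_tendsto_charFun.2 fun t => ?_
    simp only [ProbabilityMeasure.coe_mk, hchar, charFun_gaussianReal]
    have h := ((tendsto_charFun_chiSquared (a * t)).comp hd).mul
      ((tendsto_charFun_chiSquared (-b * t)).comp he)
    rw [← Complex.exp_add] at h
    refine h.trans (le_of_eq (congrArg (fun y => 𝓝 (Complex.exp y)) ?_))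
    have hab' : (a : ℂ) ^ 2 + b ^ 2 = 1 := by exact_mod_cast hab
    push_cast
    linear_combination (-t ^ 2 / 2 : ℂ) * hab'
  intro t
  -- Weak convergence gives convergence of tails, as the boundary `{t}` of the half-line is null for
  -- the normal law.
  have h := ProbabilityMeasure.tendsto_measure_of_null_frontier_of_tendsto' hlim
    (E := Set.Ioi t) (by simp)
  simp only [ProbabilityMeasure.coe_mk] at h
  replace h := (ENNReal.tendsto_toReal (measure_ne_top _ _)).comp h
  refine h.congr' ?_
  filter_upwards [hUV] with i hi
  have hm : Measurable fun w : ℝ × ℝ =>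
    a * ((w.1 - d i) / √(2 * d i)) - b * ((w.2 - e i) / √(2 * e i)) := by fun_prop
  simp only [Function.comp_apply, hμ]
  rw [Measure.map_apply hm measurableSet_Ioi, ← hi.map_eq,
    Measure.map_apply_of_aemeasurable hi.aemeasurable (hm measurableSet_Ioi)]
  rfl

/-- Two sequences of events that agree where a variable tending to zero in probability is small
have asymptotically equal probabilities. -/
lemma TendstoInProb.tendsto_sub_of_agree {ι : Type*} {Ω : ι → Type*} [∀ i, MeasurableSpace (Ω i)]
    {P : (i : ι) → Measure (Ω i)} [∀ i, IsProbabilityMeasure (P i)] {l : Filter ι}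
    {X : (i : ι) → Ω i → ℝ} (hX : TendstoInProb P X l) {δ : ℝ} (hδ : 0 < δ)
    {p q : (i : ι) → Ω i → Prop}
    (h : ∀ᶠ i in l, ∀ᵐ ω ∂P i, |X i ω| ≤ δ → (p i ω ↔ q i ω)) :
    Tendsto (fun i => (P i).real {ω | p i ω} - (P i).real {ω | q i ω}) l (𝓝 0) := by
  have key : ∀ i, ∀ p q : Ω i → Prop, (∀ᵐ ω ∂P i, |X i ω| ≤ δ → p ω → q ω) →
      (P i).real {ω | p ω} ≤ (P i).real {ω | q ω} + (P i).real {ω | δ < |X i ω|} := by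
    intro i p q h
    refine le_trans ?_ (measureReal_union_le _ _)
    refine ENNReal.toReal_mono (measure_ne_top _ _) (measure_mono_ae ?_)
    filter_upwards [h] with ω hω hp
    by_cases hx : |X i ω| ≤ δ
    · exact Or.inl (hω hx hp)
    · exact Or.inr (not_le.1 hx)
  rw [tendsto_zero_iff_abs_tendsto_zero]
  refine squeeze_zero' (Eventually.of_forall fun _ => abs_nonneg _) ?_ (hX δ hδ)
  filter_upwards [h] with i hi
  have h1 := key i (p i) (q i) (hi.mono fun ω h hx => (h hx).1)
  have h2 := key i (q i) (p i) (hi.mono fun ω h hx => (h hx).2)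
  exact abs_le.2 ⟨by linarith, by linarith⟩

/-- A standardised chi-squared variable has variance one, so Chebyshev bounds the tail by `c² / δ²`.
This absorbs the replacement of coefficients by their limits. -/
lemma tendstoInProb_mul_chiSquared {Ω : ℕ → Type*} [∀ i, MeasurableSpace (Ω i)]
    {P : (i : ℕ) → Measure (Ω i)} [∀ i, IsProbabilityMeasure (P i)] {U : (i : ℕ) → Ω i → ℝ}
    {d : ℕ → ℕ} (hU : ∀ᶠ i in atTop, HasLaw (U i) (chiSquared (d i)) (P i))
    (hd : ∀ᶠ i in atTop, 0 < d i) {c : ℕ → ℝ} (hc : Tendsto c atTop (𝓝 0)) :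
    TendstoInProb P (fun i ω => c i * ((U i ω - d i) / √(2 * d i))) atTop := by
  intro δ hδ
  have h0 : Tendsto (fun i => c i ^ 2 / δ ^ 2) atTop (𝓝 0) := by
    simpa using (hc.pow 2).div_const (δ ^ 2)
  refine squeeze_zero' (Eventually.of_forall fun _ => measureReal_nonneg) ?_ h0
  filter_upwards [hU, hd] with i hi hdi
  rcases eq_or_ne (c i) 0 with h | h
  · simp [h, hδ.not_gt]
  have hd0 : (0 : ℝ) < d i := by exact_mod_cast hdi
  have hs : 0 < √(2 * d i) := by positivity
  have h1 := chiSquared_chebyshev (d i) (δ := δ * √(2 * d i) / |c i|) (by positivity)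
  have hm : MeasurableSet {x : ℝ | δ * √(2 * d i) / |c i| < |x - d i|} :=
    measurableSet_lt (by fun_prop) (by fun_prop)
  rw [← hi.measureReal_eq hm] at h1
  refine (measureReal_mono fun ω hω => ?_).trans (h1.trans_eq ?_)
  · simp only [Set.mem_ofPred_eq] at hω ⊢
    rw [abs_mul, abs_div, abs_of_pos hs] at hω
    rw [div_lt_iff₀ (abs_pos.2 h)]
    calc δ * √(2 * d i) < |c i| * (|U i ω - d i| / √(2 * d i)) * √(2 * d i) := by gcongr
      _ = _ := by field_simp
  · rw [div_pow, mul_pow, sq_abs, Real.sq_sqrt (by positivity)]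
    field_simp

/-! ### Mean squares and F quantiles when `k / n → ρ` -/

section Sequence

variable {ρ : ℝ} {k : ℕ → ℕ}

lemma eventually_lt_of_tendsto_div (hρ : ρ ∈ Set.Ioo (0 : ℝ) 1)
    (hkn : Tendsto (fun n => (k n : ℝ) / n) atTop (𝓝 ρ)) : ∀ᶠ n in atTop, k n < n := by
  filter_upwards [hkn.eventually_lt_const hρ.2, eventually_gt_atTop 0] with n h hn
  rw [div_lt_one (by exact_mod_cast hn)] at h
  exact_mod_cast h

lemma tendsto_sub_div (hρ : ρ ∈ Set.Ioo (0 : ℝ) 1)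
    (hkn : Tendsto (fun n => (k n : ℝ) / n) atTop (𝓝 ρ)) :
    Tendsto (fun n => ((n - k n : ℕ) : ℝ) / n) atTop (𝓝 (1 - ρ)) := by
  refine (hkn.const_sub 1).congr' ?_
  filter_upwards [eventually_lt_of_tendsto_div hρ hkn] with n h
  have : (n : ℝ) ≠ 0 := by exact_mod_cast (Nat.zero_lt_of_lt h).ne'
  rw [Nat.cast_sub h.le]
  field_simp

lemma tendsto_atTop_of_tendsto_div (hρ : 0 < ρ)
    (hkn : Tendsto (fun n => (k n : ℝ) / n) atTop (𝓝 ρ)) : Tendsto k atTop atTop := by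
  rw [← tendsto_natCast_atTop_iff (R := ℝ)]
  refine (hkn.pos_mul_atTop hρ tendsto_natCast_atTop_atTop).congr' ?_
  filter_upwards [eventually_gt_atTop 0] with n hn
  have : (n : ℝ) ≠ 0 := by exact_mod_cast hn.ne'
  field_simp

lemma one_sub_mem_Ioo (hρ : ρ ∈ Set.Ioo (0 : ℝ) 1) : 1 - ρ ∈ Set.Ioo (0 : ℝ) 1 :=
  ⟨by linarith [hρ.2], by linarith [hρ.1]⟩

/-- The scale `√(n ρ (1 - ρ) / 2)` at which the `F` statistic is asymptotically normal. -/
noncomputable def fScale (ρ : ℝ) (n : ℕ) : ℝ := √(n * (ρ * (1 - ρ) / 2))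

lemma fScale_pos (hρ : ρ ∈ Set.Ioo (0 : ℝ) 1) {n : ℕ} (hn : 0 < n) : 0 < fScale ρ n := by
  have := hρ.1
  have := (one_sub_mem_Ioo hρ).1
  have : (0 : ℝ) < n := by exact_mod_cast hn
  exact Real.sqrt_pos.2 (by positivity)

lemma fScale_sq (hρ : ρ ∈ Set.Ioo (0 : ℝ) 1) (n : ℕ) :
    fScale ρ n ^ 2 = n * (ρ * (1 - ρ) / 2) := by
  have := hρ.1
  have := (one_sub_mem_Ioo hρ).1
  exact Real.sq_sqrt (by positivity)

/-- This is the weight of the standardised numerator. Exchanging `ρ` and `1 - ρ` gives the weight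
`√ρ` of the denominator, and the squares of the two weights sum to one; this dictates the scale
`fScale`. -/
lemma tendsto_fScale_mul_sqrt (hρ : ρ ∈ Set.Ioo (0 : ℝ) 1)
    (hkn : Tendsto (fun n => (k n : ℝ) / n) atTop (𝓝 ρ)) :
    Tendsto (fun n => fScale ρ n * (√(2 * k n) / k n)) atTop (𝓝 √(1 - ρ)) := by
  have h0 := hρ.1
  have h1 := (one_sub_mem_Ioo hρ).1
  have h := (Real.continuous_sqrt.tendsto _).comp
    ((hkn.inv₀ h0.ne').const_mul (ρ * (1 - ρ)))
  rw [show ρ * (1 - ρ) * ρ⁻¹ = 1 - ρ by field_simp] at h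
  refine h.congr' ?_
  filter_upwards [(tendsto_atTop_of_tendsto_div h0 hkn).eventually_gt_atTop 0,
    eventually_gt_atTop 0] with n hk hn
  have hk' : (0 : ℝ) < k n := by exact_mod_cast hk
  have hn' : (0 : ℝ) < n := by exact_mod_cast hn
  have h2 : √(2 * k n) / k n = √(2 / k n) := by
    rw [eq_comm, Real.sqrt_eq_iff_mul_self_eq (by positivity) (by positivity), ← pow_two, div_pow,
      Real.sq_sqrt (by positivity)]
    field_simp
  rw [h2, fScale, ← Real.sqrt_mul (by positivity), Function.comp_apply]
  congr 1
  field_simp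

variable {Ω : ℕ → Type*} [∀ i, MeasurableSpace (Ω i)] {P : (i : ℕ) → Measure (Ω i)}
  [∀ i, IsProbabilityMeasure (P i)] {U V : (i : ℕ) → Ω i → ℝ}

lemma HasLaw.fst_of_prod {Ω : Type*} [MeasurableSpace Ω] {P : Measure Ω} {U V : Ω → ℝ}
    {μ ν : Measure ℝ} [IsProbabilityMeasure μ] [IsProbabilityMeasure ν]
    (h : HasLaw (fun ω => (U ω, V ω)) (μ.prod ν) P) : HasLaw U μ P :=
  measurePreserving_fst.comp_hasLaw h

lemma HasLaw.snd_of_prod {Ω : Type*} [MeasurableSpace Ω] {P : Measure Ω} {U V : Ω → ℝ}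
    {μ ν : Measure ℝ} [IsProbabilityMeasure μ] [IsProbabilityMeasure ν]
    (h : HasLaw (fun ω => (U ω, V ω)) (μ.prod ν) P) : HasLaw V ν P :=
  measurePreserving_snd.comp_hasLaw h

/-- Asymptotic normality of the difference of the two mean squares of an `F` statistic. -/
lemma tailsTendsto_meanSquares (hρ : ρ ∈ Set.Ioo (0 : ℝ) 1)
    (hkn : Tendsto (fun n => (k n : ℝ) / n) atTop (𝓝 ρ))
    (hUV : ∀ᶠ n in atTop,
      HasLaw (fun ω => (U n ω, V n ω)) ((chiSquared (k n)).prod (chiSquared (n - k n))) (P n)) :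
    TailsTendsto P (fun n ω => fScale ρ n * (U n ω / k n - V n ω / (n - k n : ℕ))) atTop := by
  have h0 := hρ.1
  have h1 := (one_sub_mem_Ioo hρ).1
  have hk := tendsto_atTop_of_tendsto_div h0 hkn
  have hk' := tendsto_atTop_of_tendsto_div h1 (tendsto_sub_div hρ hkn)
  have hA := tailsTendsto_chiSquared_sub hUV hk hk' (a := √(1 - ρ)) (b := √ρ)
    (by rw [Real.sq_sqrt h1.le, Real.sq_sqrt h0.le]; ring)
  refine hA.of_sub ?_
  have hc := tendsto_fScale_mul_sqrt hρ hkn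
  have hc' := tendsto_fScale_mul_sqrt (one_sub_mem_Ioo hρ) (tendsto_sub_div hρ hkn)
  rw [sub_sub_cancel] at hc'
  have e1 := tendstoInProb_mul_chiSquared (hUV.mono fun n h => HasLaw.fst_of_prod h)
    (hk.eventually_gt_atTop 0) (sub_self √(1 - ρ) ▸ hc.sub_const √(1 - ρ))
  have e2 := tendstoInProb_mul_chiSquared (hUV.mono fun n h => HasLaw.snd_of_prod h)
    (hk'.eventually_gt_atTop 0) (sub_self √ρ ▸ hc'.const_sub √ρ)
  intro δ hδ
  refine ((e1.add e2) δ hδ).congr' ?_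
  filter_upwards [hk.eventually_gt_atTop 0, hk'.eventually_gt_atTop 0] with n hn hn'
  have p1 : (0 : ℝ) < k n := by exact_mod_cast hn
  have p2 : (0 : ℝ) < (n - k n : ℕ) := by exact_mod_cast hn'
  have p3 : √(2 * (k n : ℝ)) ≠ 0 := by positivity
  have p4 : √(2 * ((n - k n : ℕ) : ℝ)) ≠ 0 := by positivity
  have e3 : fScale (1 - ρ) n = fScale ρ n := by
    rw [fScale, fScale, sub_sub_cancel, mul_comm ρ]
  congr 1
  ext ω
  simp only [Set.mem_ofPred_eq, e3]
  refine iff_of_eq (congrArg (fun x => δ < |x|) ?_)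
  field_simp
  ring

/-- The quantiles of the `F` distribution at the scale of its asymptotic normality. -/
theorem tendsto_fQuantile (hρ : ρ ∈ Set.Ioo (0 : ℝ) 1)
    (hkn : Tendsto (fun n => (k n : ℝ) / n) atTop (𝓝 ρ)) {α : ℝ} (hα : α ∈ Set.Ioo (0 : ℝ) 1) :
    Tendsto (fun n => fScale ρ n * (fQuantile α (k n) (n - k n) - 1)) atTop
      (𝓝 (zQuantile α)) := by
  have h0 := hρ.1
  have h1 := (one_sub_mem_Ioo hρ).1
  have hk := tendsto_atTop_of_tendsto_div h0 hkn
  have hk' := tendsto_atTop_of_tendsto_div h1 (tendsto_sub_div hρ hkn)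
  set P : (n : ℕ) → Measure (ℝ × ℝ) := fun n => (chiSquared (k n)).prod (chiSquared (n - k n))
    with hP
  have hUV : ∀ᶠ n in atTop, HasLaw (fun w : ℝ × ℝ => (w.1, w.2)) (P n) (P n) :=
    Eventually.of_forall fun n => HasLaw.id
  have hA := tailsTendsto_meanSquares hρ hkn hUV
  have hV := tendstoInProb_chiSquared_div (hUV.mono fun n h => HasLaw.snd_of_prod h) hk'
  have key : ∀ y, Tendsto (fun n => (fDist (k n) (n - k n)).real (Set.Ioi (1 + y / fScale ρ n)))
      atTop (𝓝 (gTail y)) := by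
    intro y
    -- With `c = fScale ρ n`, `u = U/k` and `v = V/(n - k) > 0`, multiplying `1 + y/c < u/v` by `c
    -- v` turns it into `y < c (u - v) - y (v - 1)`, whose last term vanishes in probability.
    have hB := hA.of_sub (B := fun n w => fScale ρ n * (w.1 / k n - w.2 / (n - k n : ℕ)) +
      -y * (w.2 / (n - k n : ℕ) - 1))
      (by simpa only [add_sub_cancel_left] using hV.mul_of_tendsto tendsto_const_nhds)
    have h2 := hV.tendsto_sub_of_agree (δ := 1 / 2) (by norm_num)
      (p := fun n w => 1 + y / fScale ρ n < (w.1 / k n) / (w.2 / (n - k n : ℕ)))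
      (q := fun n w => y < fScale ρ n * (w.1 / k n - w.2 / (n - k n : ℕ)) +
        -y * (w.2 / (n - k n : ℕ) - 1)) ?_
    · refine (by simpa using h2.add (hB y) :
        Tendsto _ atTop (𝓝 (gTail y))).congr fun n => ?_
      rw [fDist, map_measureReal_apply (by fun_prop) measurableSet_Ioi]
      rfl
    · filter_upwards [eventually_gt_atTop 0] with n hn
      refine ae_of_all _ fun w hw => ?_
      have hc := fScale_pos hρ hn
      have hv : 0 < w.2 / (n - k n : ℕ) := by linarith [(abs_le.1 hw).1]
      rw [lt_div_iff₀ hv, ← mul_lt_mul_iff_right₀ hc]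
      have : fScale ρ n * ((1 + y / fScale ρ n) * (w.2 / (n - k n : ℕ))) =
        fScale ρ n * (w.2 / (n - k n : ℕ)) + y * (w.2 / (n - k n : ℕ)) := by
        field_simp
      rw [this]
      constructor <;> intro h <;> linarith
  have hanti : ∀ n, Antitone fun x => (fDist (k n) (n - k n)).real (Set.Ioi x) := by
    intro n x y hxy
    have : IsFiniteMeasure (fDist (k n) (n - k n)) := by
      unfold fDist; infer_instance
    exact measureReal_mono (Set.Ioi_subset_Ioi hxy)
  -- The limiting tail crosses `α` strictly at `z_α`, so any `y` on either side bounds the rescaled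
  -- quantile. The comparisons at `zQuantile α ± 1` only make the defining set nonempty and bounded
  -- below, without which its `sInf` would be a default value.
  refine tendsto_order.2 ⟨fun a ha => ?_, fun a ha => ?_⟩
  · obtain ⟨y, hay, hy⟩ := exists_between ha
    filter_upwards [(key y).eventually_const_lt (lt_gTail_of_lt_zQuantile hα.2 hy),
      (key (zQuantile α + 1)).eventually_lt_const (gTail_lt_of_zQuantile_lt hα.1 (lt_add_one _)),
      eventually_gt_atTop 0] with n h h' hn
    have hc := fScale_pos hρ hn
    have : 1 + y / fScale ρ n ≤ fQuantile α (k n) (n - k n) := by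
      refine le_csInf ⟨_, h'.le⟩ fun x hx => ?_
      by_contra! hlt
      exact (h.trans_le (hanti n hlt.le)).not_ge hx
    rw [← le_sub_iff_add_le', div_le_iff₀' hc] at this
    linarith
  · obtain ⟨y, hy, hya⟩ := exists_between ha
    filter_upwards [(key y).eventually_lt_const (gTail_lt_of_zQuantile_lt hα.1 hy),
      (key (zQuantile α - 1)).eventually_const_lt (lt_gTail_of_lt_zQuantile hα.2 (sub_one_lt _)),
      eventually_gt_atTop 0] with n h h' hn
    have hc := fScale_pos hρ hn
    have : fQuantile α (k n) (n - k n) ≤ 1 + y / fScale ρ n := by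
      refine csInf_le ⟨1 + (zQuantile α - 1) / fScale ρ n, fun x hx => ?_⟩ h.le
      by_contra! hlt
      exact (h'.trans_le (hanti n hlt.le)).not_ge hx
    rw [← sub_le_iff_le_add', le_div_iff₀' hc] at this
    linarith

end Sequence

/-! ### Asymptotic power from the chi-squared decomposition -/

/-- Asymptotic power of the `F` test when the signal contributes `2 T + D M` to the numerator,
with `D → 0`, `M` chi-squared and `T` of variance at most `n D`. -/
theorem tendsto_power_sub_gTail {ρ : ℝ} {k : ℕ → ℕ} {Ω : ℕ → Type*}
    [∀ i, MeasurableSpace (Ω i)] {P : (i : ℕ) → Measure (Ω i)} [∀ i, IsProbabilityMeasure (P i)]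
    {U V T M F : (i : ℕ) → Ω i → ℝ} {α : ℝ} (hα : α ∈ Set.Ioo (0 : ℝ) 1)
    (hρ : ρ ∈ Set.Ioo (0 : ℝ) 1) (hkn : Tendsto (fun n => (k n : ℝ) / n) atTop (𝓝 ρ))
    {D : ℕ → ℝ} (hD : Tendsto D atTop (𝓝 0))
    (hUV : ∀ᶠ n in atTop,
      HasLaw (fun ω => (U n ω, V n ω)) ((chiSquared (k n)).prod (chiSquared (n - k n))) (P n))
    (hM : ∀ᶠ n in atTop, HasLaw (M n) (chiSquared n) (P n))
    (hT : ∀ᶠ n in atTop, ∀ δ : ℝ, 0 < δ → (P n).real {ω | δ < |T n ω|} ≤ n * D n / δ ^ 2)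
    (hF : ∀ᶠ n in atTop, ∀ᵐ ω ∂P n,
      F n ω = ((U n ω + 2 * T n ω + D n * M n ω) / k n) / (V n ω / (n - k n : ℕ)))
    {m κ : ℕ → ℝ} (hm : ∀ n, 0 ≤ m n)
    (hmD : ∀ᶠ n in atTop, m n = √((1 - ρ) * n / (2 * ρ)) * (κ n * D n))
    (hκ : Tendsto κ atTop (𝓝 1)) :
    Tendsto (fun n => (P n).real {ω | fQuantile α (k n) (n - k n) < F n ω} -
      gTail (zQuantile α - m n)) atTop (𝓝 0) := by
  have h0 := hρ.1
  have h1 := (one_sub_mem_Ioo hρ).1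
  have hk := tendsto_atTop_of_tendsto_div h0 hkn
  have hk' := tendsto_atTop_of_tendsto_div h1 (tendsto_sub_div hρ hkn)
  have hV := tendstoInProb_chiSquared_div (hUV.mono fun n h => HasLaw.snd_of_prod h) hk'
  have hM' := tendstoInProb_chiSquared_div hM tendsto_id
  have hq := tendsto_fQuantile hρ hkn hα
  set q : ℕ → ℝ := fun n => fQuantile α (k n) (n - k n) with hqdef
  -- the relative error of the drift
  set c : ℕ → ℝ := fun n => ρ * (n / k n) / κ n with hcdef
  have hc : Tendsto c atTop (𝓝 1) := by
    have := ((hkn.inv₀ h0.ne').const_mul ρ).div hκ one_ne_zero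
    rw [mul_inv_cancel₀ h0.ne', div_one] at this
    exact this.congr fun n => by simp [hcdef]
  have hr : TendstoInProb P (fun n ω => c n * (M n ω / n - 1) + (c n - 1)) atTop :=
    (hM'.mul_of_tendsto hc).add (tendstoInProb_of_tendsto (by simpa using hc.sub_const 1))
  -- the cross term
  have hT' : TendstoInProb P (fun n ω => 2 * fScale ρ n / k n * T n ω) atTop := by
    intro δ hδ
    -- The factor `(2 fScale / k)²` times the bound `n D` equals `2ρ(1 - ρ) (n/k)² D`, which tends
    -- to zero with `D`.
    have hlim : Tendsto (fun n => 2 * (ρ * (1 - ρ)) / δ ^ 2 * (((k n : ℝ) / n)⁻¹ ^ 2 * D n)) atTop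
        (𝓝 0) := by
      simpa using (((hkn.inv₀ h0.ne').pow 2).mul hD).const_mul (2 * (ρ * (1 - ρ)) / δ ^ 2)
    refine squeeze_zero' (Eventually.of_forall fun _ => measureReal_nonneg) ?_ hlim
    filter_upwards [hT, hk.eventually_gt_atTop 0, eventually_gt_atTop 0] with n hTn hkn hn
    have hs := fScale_pos hρ hn
    have hkn' : (0 : ℝ) < k n := by exact_mod_cast hkn
    have hn' : (0 : ℝ) < n := by exact_mod_cast hn
    have h2 : 0 < 2 * fScale ρ n / k n := by positivity
    refine le_trans (measureReal_mono fun ω hω => ?_)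
      ((hTn (δ / (2 * fScale ρ n / k n)) (by positivity)).trans_eq ?_)
    · simp only [Set.mem_ofPred_eq] at hω ⊢
      rw [abs_mul, abs_of_pos h2] at hω
      rwa [div_lt_iff₀' h2]
    · have h3 := fScale_sq hρ n
      rw [div_pow, div_pow, mul_pow, h3]
      field_simp
  have he : TendstoInProb P (fun n ω => 2 * fScale ρ n / k n * T n ω +
      ((-1 * (fScale ρ n * (q n - 1))) * (V n ω / (n - k n : ℕ) - 1) +
        (zQuantile α - fScale ρ n * (q n - 1)))) atTop :=
    hT'.add ((hV.mul_of_tendsto (hq.const_mul (-1))).add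
      (tendstoInProb_of_tendsto (by simpa using hq.const_sub (zQuantile α))))
  have main := (tailsTendsto_meanSquares hρ hkn hUV).tendsto_drift hr he hm (zQuantile α)
  -- For `v = V/(n - k)`, the event `q < F` is cleared of its denominator where `|v - 1| ≤ 1/2`. The
  -- term `c (q - 1) v` is then split into `c (q - 1)(v - 1)`, which is negligible, and `c (q - 1)`,
  -- which is close to `z_α`.
  have agree := hV.tendsto_sub_of_agree (δ := 1 / 2) (by norm_num)
    (p := fun n ω => q n < F n ω)
    (q := fun n ω => zQuantile α < fScale ρ n * (U n ω / k n - V n ω / (n - k n : ℕ)) +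
      m n * (1 + (c n * (M n ω / n - 1) + (c n - 1))) + (2 * fScale ρ n / k n * T n ω +
      ((-1 * (fScale ρ n * (q n - 1))) * (V n ω / (n - k n : ℕ) - 1) +
        (zQuantile α - fScale ρ n * (q n - 1))))) ?_
  · simpa using agree.add main
  filter_upwards [hF, hmD, hk.eventually_gt_atTop 0, eventually_gt_atTop 0,
    hκ.eventually_ne one_ne_zero] with n hFn hmn hkn hn hκn
  filter_upwards [hFn] with ω hω hv
  have hs := fScale_pos hρ hn
  have hkn' : (0 : ℝ) < k n := by exact_mod_cast hkn
  have hn' : (0 : ℝ) < n := by exact_mod_cast hn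
  have hv : 0 < V n ω / (n - k n : ℕ) := by linarith [(abs_le.1 hv).1]
  rw [hω, lt_div_iff₀ hv, ← mul_lt_mul_iff_right₀ hs]
  -- The scale and the drift factor are related by `fScale = ρ √((1 - ρ) n / (2ρ))`.
  have hsm : m n * ρ = fScale ρ n * (κ n * D n) := by
    have : fScale ρ n = √((1 - ρ) * n / (2 * ρ)) * ρ := by
      rw [fScale, Real.sqrt_eq_iff_mul_self_eq (by positivity) (by positivity), ← pow_two, mul_pow,
        Real.sq_sqrt (by positivity)]
      field_simp
    rw [hmn, this]
    ring
  have hdrift : m n * (1 + (c n * (M n ω / n - 1) + (c n - 1))) =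
      fScale ρ n * (D n * M n ω / k n) := by
    have : m n * (1 + (c n * (M n ω / n - 1) + (c n - 1))) = m n * ρ * (M n ω / (k n * κ n)) := by
      simp only [hcdef]
      field_simp
      ring
    rw [this, hsm]
    field_simp
  rw [hdrift]
  have e1 : fScale ρ n * ((U n ω + 2 * T n ω + D n * M n ω) / k n) = fScale ρ n * (U n ω / k n) +
      2 * fScale ρ n / k n * T n ω + fScale ρ n * (D n * M n ω / k n) := by
    ring
  rw [e1]
  constructor <;> intro h <;> linarith

/-! ### The hat matrix and Cochran's theorem -/

/-- The hat matrix `W (Wᵀ W)⁻¹ Wᵀ` of a regression on `W`. -/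
noncomputable def hatMatrix {n k : ℕ} (W : Matrix (Fin n) (Fin k) ℝ) :
    Matrix (Fin n) (Fin n) ℝ :=
  W * (Wᵀ * W)⁻¹ * Wᵀ

section Hat

variable {n k : ℕ} {W : Matrix (Fin n) (Fin k) ℝ}

lemma hatMatrix_mulVec_of_range (hW : (Wᵀ * W).det ≠ 0) (g : Fin k → ℝ) :
    hatMatrix W *ᵥ (W *ᵥ g) = W *ᵥ g := by
  rw [hatMatrix, Matrix.mulVec_mulVec, Matrix.mul_assoc, Matrix.mul_assoc,
    Matrix.nonsing_inv_mul _ (isUnit_iff_ne_zero.2 hW), Matrix.mul_one]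

lemma hatMatrix_mulVec_of_orthogonal {b : Fin n → ℝ} (h : Wᵀ *ᵥ b = 0) :
    hatMatrix W *ᵥ b = 0 := by
  rw [hatMatrix, ← Matrix.mulVec_mulVec, h, Matrix.mulVec_zero]

lemma transpose_hatMatrix : (hatMatrix W)ᵀ = hatMatrix W := by
  simp [hatMatrix, Matrix.transpose_mul, Matrix.transpose_nonsing_inv, Matrix.mul_assoc]

lemma hatMatrix_mul_self (hW : (Wᵀ * W).det ≠ 0) : hatMatrix W * hatMatrix W = hatMatrix W := by
  simp only [hatMatrix, Matrix.mul_assoc]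
  rw [← Matrix.mul_assoc Wᵀ, ← Matrix.mul_assoc (Wᵀ * W)⁻¹ (Wᵀ * W),
    Matrix.nonsing_inv_mul _ (isUnit_iff_ne_zero.2 hW), Matrix.one_mul]

lemma dotProduct_hatMatrix_mulVec_comm (a b : Fin n → ℝ) :
    a ⬝ᵥ (hatMatrix W *ᵥ b) = b ⬝ᵥ (hatMatrix W *ᵥ a) := by
  rw [Matrix.dotProduct_mulVec, ← Matrix.mulVec_transpose, transpose_hatMatrix, dotProduct_comm]

lemma sketchedF_eq_hatMatrix {p : ℕ} (X : Matrix (Fin n) (Fin p) ℝ) (y : Fin n → ℝ)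
    (S : Matrix (Fin p) (Fin k) ℝ) (hW : ((X * S)ᵀ * (X * S)).det ≠ 0) :
    sketchedF X y S = ((y ⬝ᵥ (hatMatrix (X * S) *ᵥ y)) / k) /
      ((y ⬝ᵥ y - y ⬝ᵥ (hatMatrix (X * S) *ᵥ y)) / ((n : ℝ) - k)) := by
  have h : (X * S) *ᵥ sketchedLSE X y S = hatMatrix (X * S) *ᵥ y := by
    rw [sketchedLSE, Matrix.mulVec_mulVec, hatMatrix, Matrix.transpose_mul]
    simp only [Matrix.mul_assoc]
  have h2 : ∑ i, sketchedResidual X y S i ^ 2 =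
      y ⬝ᵥ y - y ⬝ᵥ (hatMatrix (X * S) *ᵥ y) := by
    have h3 : ∑ i, sketchedResidual X y S i ^ 2 =
        (y - hatMatrix (X * S) *ᵥ y) ⬝ᵥ (y - hatMatrix (X * S) *ᵥ y) := by
      simp [sketchedResidual, h, dotProduct, pow_two]
    have h4 : (hatMatrix (X * S) *ᵥ y) ⬝ᵥ (hatMatrix (X * S) *ᵥ y) =
        y ⬝ᵥ (hatMatrix (X * S) *ᵥ y) := by
      rw [dotProduct_hatMatrix_mulVec_comm, Matrix.mulVec_mulVec, hatMatrix_mul_self hW]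
    rw [h3, sub_dotProduct, dotProduct_sub, dotProduct_sub, h4,
      dotProduct_comm (hatMatrix (X * S) *ᵥ y) y]
    ring
  rw [sketchedF, h, h2]

/-- The sketched `F` statistic in terms of the signal `W g` and the standardized noise `e`. -/
lemma sketchedF_eq {p : ℕ} (X : Matrix (Fin n) (Fin p) ℝ) (S : Matrix (Fin p) (Fin k) ℝ)
    (hW : ((X * S)ᵀ * (X * S)).det ≠ 0) (g : Fin k → ℝ) (e : Fin n → ℝ) {s : ℝ} (hs : s ≠ 0) :
    sketchedF X ((X * S) *ᵥ g + s • e) S =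
      ((e ⬝ᵥ (hatMatrix (X * S) *ᵥ e) + 2 * (s⁻¹ * (e ⬝ᵥ ((X * S) *ᵥ g))) +
        (s ^ 2)⁻¹ * (((X * S) *ᵥ g) ⬝ᵥ ((X * S) *ᵥ g))) / k) /
      ((e ⬝ᵥ e - e ⬝ᵥ (hatMatrix (X * S) *ᵥ e)) / ((n : ℝ) - k)) := by
  rw [sketchedF_eq_hatMatrix X _ S hW]
  set w := (X * S) *ᵥ g with hw
  have h1 : hatMatrix (X * S) *ᵥ w = w := hatMatrix_mulVec_of_range hW g
  have h2 : w ⬝ᵥ (hatMatrix (X * S) *ᵥ e) = e ⬝ᵥ w := by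
    rw [dotProduct_hatMatrix_mulVec_comm, h1]
  simp only [Matrix.mulVec_add, Matrix.mulVec_smul, h1, add_dotProduct, dotProduct_add,
    smul_dotProduct, dotProduct_smul, h2, smul_eq_mul, dotProduct_comm w e]
  have hnum : w ⬝ᵥ w + s * (e ⬝ᵥ w) + s * (e ⬝ᵥ w + s * (e ⬝ᵥ (hatMatrix (X * S) *ᵥ e))) =
      s ^ 2 * (e ⬝ᵥ (hatMatrix (X * S) *ᵥ e) + 2 * (s⁻¹ * (e ⬝ᵥ w)) + (s ^ 2)⁻¹ * (w ⬝ᵥ w)) := by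
    field_simp
    ring
  have hden : w ⬝ᵥ w + s * (e ⬝ᵥ w) + s * (e ⬝ᵥ w + s * (e ⬝ᵥ e)) -
      (w ⬝ᵥ w + s * (e ⬝ᵥ w) + s * (e ⬝ᵥ w + s * (e ⬝ᵥ (hatMatrix (X * S) *ᵥ e)))) =
      s ^ 2 * (e ⬝ᵥ e - e ⬝ᵥ (hatMatrix (X * S) *ᵥ e)) := by
    ring
  rw [hden, hnum, mul_div_assoc (s ^ 2) _ (k : ℝ), mul_div_assoc (s ^ 2) _ ((n : ℝ) - k),
    mul_div_mul_left _ _ (pow_ne_zero 2 hs)]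

end Hat

/-- The quadratic forms of a standard Gaussian vector in the hat matrix and its complement. -/
theorem hasLaw_hatMatrix {n k : ℕ} (W : Matrix (Fin n) (Fin k) ℝ) (hW : (Wᵀ * W).det ≠ 0) :
    HasLaw (fun e : EuclideanSpace ℝ (Fin n) =>
      ((e.ofLp ⬝ᵥ (hatMatrix W *ᵥ e.ofLp),
        e.ofLp ⬝ᵥ e.ofLp - e.ofLp ⬝ᵥ (hatMatrix W *ᵥ e.ofLp)) : ℝ × ℝ))
      ((chiSquared k).prod (chiSquared (n - k))) (stdGaussian (EuclideanSpace ℝ (Fin n))) := by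
  set K : Submodule ℝ (EuclideanSpace ℝ (Fin n)) :=
    LinearMap.range (W.toEuclideanLin (𝕜 := ℝ)) with hK
  have hinj : Function.Injective (W.toEuclideanLin (𝕜 := ℝ)) := by
    rw [← LinearMap.ker_eq_bot, LinearMap.ker_eq_bot']
    intro g hg
    have h1 : W *ᵥ g.ofLp = 0 := by simpa using congrArg WithLp.ofLp hg
    have h2 : (Wᵀ * W) *ᵥ g.ofLp = 0 := by rw [← Matrix.mulVec_mulVec, h1, Matrix.mulVec_zero]
    simpa using Matrix.eq_zero_of_mulVec_eq_zero hW h2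
  have hdim : Module.finrank ℝ K = k := by
    rw [hK, LinearMap.finrank_range_of_inj hinj]
    simp
  have hdim' : Module.finrank ℝ Kᗮ = n - k := by
    have := K.finrank_add_finrank_orthogonal
    rw [hdim, finrank_euclideanSpace_fin] at this
    omega
  -- In an orthonormal basis adapted to the column space and its complement, the two forms are sums
  -- of squares over disjoint blocks of coordinates. By rotation invariance these coordinates are
  -- again i.i.d. standard normal.
  set b : OrthonormalBasis (Fin k ⊕ Fin (n - k)) ℝ (EuclideanSpace ℝ (Fin n)) :=
    (((stdOrthonormalBasis ℝ K).reindex (finCongr hdim)).prod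
      ((stdOrthonormalBasis ℝ Kᗮ).reindex (finCongr hdim'))).map
        K.orthogonalDecomposition.symm with hb
  have hbl : ∀ i, b (Sum.inl i) ∈ K := by
    intro i
    simp [hb]
  have hbr : ∀ i, b (Sum.inr i) ∈ Kᗮ := by
    intro i
    simp [hb]
  have hHl : ∀ i, hatMatrix W *ᵥ (b (Sum.inl i)).ofLp = (b (Sum.inl i)).ofLp := by
    intro i
    obtain ⟨g, hg⟩ := hbl i
    rw [← hg]
    exact hatMatrix_mulVec_of_range hW g.ofLp
  have hHr : ∀ i, hatMatrix W *ᵥ (b (Sum.inr i)).ofLp = 0 := by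
    intro i
    refine hatMatrix_mulVec_of_orthogonal (funext fun j => ?_)
    have h1 := (Submodule.mem_orthogonal K _).1 (hbr i) _
      (LinearMap.mem_range_self (W.toEuclideanLin (𝕜 := ℝ)) (EuclideanSpace.single j 1))
    rw [EuclideanSpace.inner_eq_star_dotProduct] at h1
    have h2 : (W.toEuclideanLin (𝕜 := ℝ) (EuclideanSpace.single j 1)).ofLp = W.col j := by simp
    rw [star_trivial, h2, dotProduct_comm] at h1
    exact h1
  have hsum : ∀ (x : Fin k ⊕ Fin (n - k) → ℝ),
      (∑ i, x i • b i).ofLp ⬝ᵥ (hatMatrix W *ᵥ (∑ i, x i • b i).ofLp) =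
        ∑ i, x (Sum.inl i) ^ 2 := by
    intro x
    have h1 : hatMatrix W *ᵥ (∑ i, x i • b i).ofLp =
        (∑ i, (Sum.elim (fun i => x (Sum.inl i)) 0 : _ → ℝ) i • b i).ofLp := by
      simp [Matrix.mulVec_add, Matrix.mulVec_sum, Matrix.mulVec_smul, hHl, hHr]
    have h2 := b.orthonormal.inner_sum (Sum.elim (fun i => x (Sum.inl i)) 0) x Finset.univ
    rw [EuclideanSpace.inner_eq_star_dotProduct, star_trivial] at h2
    rw [h1, h2]
    simp [pow_two]
  have hsum' : ∀ (x : Fin k ⊕ Fin (n - k) → ℝ),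
      (∑ i, x i • b i).ofLp ⬝ᵥ (∑ i, x i • b i).ofLp =
        ∑ i, x (Sum.inl i) ^ 2 + ∑ i, x (Sum.inr i) ^ 2 := by
    intro x
    have h2 := b.orthonormal.inner_sum x x Finset.univ
    rw [EuclideanSpace.inner_eq_star_dotProduct, star_trivial] at h2
    rw [h2]
    simp [pow_two]
  have hmeas : Measurable (fun e : EuclideanSpace ℝ (Fin n) =>
      ((e.ofLp ⬝ᵥ (hatMatrix W *ᵥ e.ofLp),
        e.ofLp ⬝ᵥ e.ofLp - e.ofLp ⬝ᵥ (hatMatrix W *ᵥ e.ofLp)) : ℝ × ℝ)) := by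
    have h1 : Continuous fun e : EuclideanSpace ℝ (Fin n) => e.ofLp := by fun_prop
    exact ((h1.dotProduct (continuous_const.matrix_mulVec h1)).prodMk ((h1.dotProduct h1).sub
      (h1.dotProduct (continuous_const.matrix_mulVec h1)))).measurable
  refine ⟨hmeas.aemeasurable, ?_⟩
  rw [stdGaussian_eq_map_pi_orthonormalBasis b, Measure.map_map hmeas (by fun_prop), chiSquared,
    chiSquared, Measure.map_prod_map _ _ measurable_sum_sq measurable_sum_sq,
    ← (measurePreserving_sumPiEquivProdPi fun _ => gaussianReal 0 1).map_eq,
    Measure.map_map (by fun_prop) (MeasurableEquiv.measurable _)]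
  refine congrArg (fun f => Measure.map f _) (funext fun x => ?_)
  simp only [Function.comp_apply, hsum, hsum', add_sub_cancel_left]
  rfl

/-! ### Almost sure nondegeneracy of sketches and designs -/

/-- The zero set of a nonzero polynomial is null for a product of diffuse measures. -/
lemma ae_eval_ne_zero_fin (μ : Measure ℝ) [IsProbabilityMeasure μ] [NullSingletonClass μ] :
    ∀ (m : ℕ) (f : MvPolynomial (Fin m) ℝ), f ≠ 0 →
      ∀ᵐ x ∂(Measure.pi fun _ : Fin m => μ), MvPolynomial.eval x f ≠ 0
  | 0, f, hf => by
    refine ae_of_all _ fun x h => hf ?_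
    rw [MvPolynomial.eq_C_of_isEmpty f] at h ⊢
    simpa using h
  | m + 1, f, hf => by
    have hp := (measurePreserving_piFinSuccAbove (fun _ : Fin (m + 1) => μ) 0).symm
    have hmeas : Measurable fun x : Fin (m + 1) → ℝ => MvPolynomial.eval x f :=
      (MvPolynomial.continuous_eval f).measurable
    have hset : MeasurableSet {x : Fin (m + 1) → ℝ | MvPolynomial.eval x f ≠ 0} :=
      (hmeas (measurableSet_singleton 0)).compl
    rw [← hp.map_eq, ae_map_iff hp.measurable.aemeasurable hset]
    have hmeas2 : MeasurableSet {w : ℝ × (Fin m → ℝ) | MvPolynomial.eval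
        ((MeasurableEquiv.piFinSuccAbove (fun _ => ℝ) 0).symm w) f ≠ 0} :=
      hp.measurable hset
    -- The factors are swapped so that Fubini fixes the last `m` variables first and leaves the
    -- zeroth one to the inner fibre.
    have hswap : ∀ᵐ w ∂(Measure.pi fun _ : Fin m => μ).prod μ, MvPolynomial.eval
        ((MeasurableEquiv.piFinSuccAbove (fun _ => ℝ) 0).symm w.swap) f ≠ 0 := by
      have hmeas3 : MeasurableSet {w : (Fin m → ℝ) × ℝ | MvPolynomial.eval
          ((MeasurableEquiv.piFinSuccAbove (fun _ => ℝ) 0).symm w.swap) f ≠ 0} :=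
        measurable_swap hmeas2
      rw [Measure.ae_prod_iff_ae_ae hmeas3]
      -- By induction the leading coefficient in the zeroth variable is nonzero for almost all
      -- values of the others. The remaining one-variable polynomial then has finitely many roots, a
      -- null set for a diffuse measure.
      have hlead : (MvPolynomial.finSuccEquiv ℝ m f).leadingCoeff ≠ 0 := by
        rwa [Polynomial.leadingCoeff_ne_zero, ne_eq, EmbeddingLike.map_eq_zero_iff]
      filter_upwards [ae_eval_ne_zero_fin μ m _ hlead] with x hx
      have hq : (MvPolynomial.finSuccEquiv ℝ m f).map (MvPolynomial.eval x) ≠ 0 := by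
        intro h0
        apply hx
        have := congrArg (fun q => q.coeff (MvPolynomial.finSuccEquiv ℝ m f).natDegree) h0
        simpa using this
      have hfin : μ ((MvPolynomial.finSuccEquiv ℝ m f).map
          (MvPolynomial.eval x)).roots.toFinset = 0 := Finset.measure_zero _ _
      filter_upwards [measure_eq_zero_iff_ae_notMem.1 hfin] with y hy h0
      apply hy
      simp only [Finset.mem_coe, Multiset.mem_toFinset, Polynomial.mem_roots hq,
        Polynomial.IsRoot.def]
      rw [← MvPolynomial.eval_eq_eval_mv_eval', ← h0]
      simp only [MeasurableEquiv.piFinSuccAbove, Fin.insertNthEquiv_zero]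
      rfl
    rw [← Measure.prod_swap, ae_map_iff measurable_swap.aemeasurable hmeas2]
    exact hswap

lemma ae_eval_ne_zero {ι : Type*} [Fintype ι] (μ : Measure ℝ) [IsProbabilityMeasure μ]
    [NullSingletonClass μ] (f : MvPolynomial ι ℝ) (hf : f ≠ 0) :
    ∀ᵐ x ∂(Measure.pi fun _ : ι => μ), MvPolynomial.eval x f ≠ 0 := by
  have e := Fintype.equivFin ι
  have hp := measurePreserving_piCongrLeft (fun _ : ι => μ) e.symm
  have hset : MeasurableSet {x : ι → ℝ | MvPolynomial.eval x f ≠ 0} :=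
    ((MvPolynomial.continuous_eval f).measurable (measurableSet_singleton 0)).compl
  rw [← hp.map_eq, ae_map_iff hp.measurable.aemeasurable hset]
  have h := ae_eval_ne_zero_fin μ _ (MvPolynomial.rename e f)
    (by rwa [ne_eq, ← map_zero (MvPolynomial.rename e),
      (MvPolynomial.rename_injective e e.injective).eq_iff])
  filter_upwards [h] with x hx
  rw [MvPolynomial.eval_rename] at hx
  convert hx using 3
  ext i
  obtain ⟨j, rfl⟩ := e.symm.surjective i
  rw [MeasurableEquiv.coe_piCongrLeft, Equiv.piCongrLeft_apply_apply]
  simp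

/-- The determinant of a matrix of polynomials in independent standard normal variables vanishes
with probability zero unless it vanishes identically. -/
lemma ae_det_ne_zero {ι : Type*} [Fintype ι] {k : ℕ} (N : Matrix (Fin k) (Fin k) (MvPolynomial ι ℝ))
    (h : ∃ Z, (N.map (MvPolynomial.eval Z)).det ≠ 0) :
    ∀ᵐ Z ∂(Measure.pi fun _ : ι => gaussianReal 0 1), (N.map (MvPolynomial.eval Z)).det ≠ 0 := by
  have key : ∀ Z, MvPolynomial.eval Z N.det = (N.map (MvPolynomial.eval Z)).det :=
    fun Z => RingHom.map_det _ _
  simp only [← key] at h ⊢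
  obtain ⟨Z, hZ⟩ := h
  exact ae_eval_ne_zero _ _ fun h0 => hZ (by rw [h0, map_zero])

/-- A Gaussian sketch is nondegenerate for a covariance matrix of large enough rank. -/
lemma ae_det_sketch_ne_zero {p k : ℕ} {C : Matrix (Fin p) (Fin p) ℝ} (hC : C.PosSemidef)
    (hk : k ≤ C.rank) {Ω : Type*} [MeasurableSpace Ω] {Q : Measure Ω} [IsProbabilityMeasure Q]
    {S : Ω → Matrix (Fin p) (Fin k) ℝ} (hS : IsGaussianSketch Q S) :
    ∀ᵐ ω ∂Q, ((S ω)ᵀ * C * S ω).det ≠ 0 := by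
  -- The columns of `S₀` are preimages of `k` independent vectors in the range of `C`. If `S₀ᵀ C S₀
  -- g = 0`, semidefiniteness forces `C S₀ g = 0`, hence `g = 0`.
  obtain ⟨S₀, hS₀⟩ : ∃ S₀ : Matrix (Fin p) (Fin k) ℝ, (S₀ᵀ * C * S₀).det ≠ 0 := by
    obtain ⟨f, hf⟩ := exists_linearIndependent_of_le_finrank
      (R := ℝ) (M := LinearMap.range C.mulVecLin) hk
    choose s hs using fun j => (f j).2
    refine ⟨(Matrix.of s).transpose, fun h0 => ?_⟩
    obtain ⟨g, hg0, hg⟩ := Matrix.exists_mulVec_eq_zero_iff.2 h0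
    have h1 : C *ᵥ ((Matrix.of s).transpose *ᵥ g) = 0 := by
      rw [← hC.dotProduct_mulVec_zero_iff, star_trivial, Matrix.mulVec_mulVec,
        Matrix.dotProduct_mulVec, Matrix.vecMul_mulVec, ← Matrix.dotProduct_mulVec,
        ← Matrix.mul_assoc, hg, dotProduct_zero]
    have h2 : ∑ j, g j • f j = 0 := by
      ext i
      have := congrFun h1 i
      rw [Matrix.mulVec_transpose (Matrix.of s), Matrix.vecMul_eq_sum, Matrix.mulVec_sum] at this
      simp only [Matrix.mulVec_smul, Finset.sum_apply, Pi.smul_apply, smul_eq_mul, Pi.zero_apply] at this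
      simp only [Submodule.coe_sum, Submodule.coe_smul, ← hs, Finset.sum_apply, Pi.smul_apply,
        smul_eq_mul, Submodule.coe_zero, Pi.zero_apply]
      exact this
    exact hg0 (funext (Fintype.linearIndependent_iff.1 hf g h2))
  set Z : Matrix (Fin p) (Fin k) (MvPolynomial (Fin p × Fin k) ℝ) :=
    Matrix.of fun i j => MvPolynomial.X (i, j) with hZ
  set C' : Matrix (Fin p) (Fin p) (MvPolynomial (Fin p × Fin k) ℝ) := C.map MvPolynomial.C with hC'
  have hmap : ∀ x : Fin p × Fin k → ℝ,
      (Zᵀ * C' * Z).map (MvPolynomial.eval x) =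
        (Matrix.of fun i j => x (i, j))ᵀ * C * (Matrix.of fun i j => x (i, j)) := by
    intro x
    have h1 : Z.map (MvPolynomial.eval x) = Matrix.of fun i j => x (i, j) := by
      ext
      simp [hZ]
    have h2 : C'.map (MvPolynomial.eval x) = C := by
      ext
      simp [hC']
    rw [Matrix.map_mul, Matrix.map_mul, Matrix.transpose_map, h1, h2]
  have hex : ∃ x : Fin p × Fin k → ℝ, ((Zᵀ * C' * Z).map (MvPolynomial.eval x)).det ≠ 0 :=
    ⟨Function.uncurry S₀, by rw [hmap]; exact hS₀⟩
  have h := ae_det_ne_zero (Zᵀ * C' * Z) hex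
  simp only [hmap] at h
  have hlaw := hS.indep.hasLaw_pi fun ij : Fin p × Fin k => hS.law ij.1 ij.2
  rw [← hlaw.map_eq] at h
  exact ae_of_ae_map hlaw.aemeasurable h

section Design

open scoped MatrixOrder

lemma multivariateGaussian_eq_map_pi {p : ℕ} (C : Matrix (Fin p) (Fin p) ℝ) :
    multivariateGaussian 0 C = (Measure.pi fun _ : Fin p => gaussianReal 0 1).map
      fun g => WithLp.toLp 2 (CFC.sqrt C *ᵥ g) := by
  rw [multivariateGaussian, ← map_pi_eq_stdGaussian, Measure.map_map (by fun_prop) (by fun_prop)]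
  refine congrArg (fun f => Measure.map f _) (funext fun g => ?_)
  simp

/-- The rows of a Gaussian design as an image of a matrix of independent normal variables. -/
lemma pi_multivariateGaussian_eq_map {n p : ℕ} (C : Matrix (Fin p) (Fin p) ℝ) :
    (Measure.pi fun _ : Fin n => multivariateGaussian 0 C) =
      (Measure.pi fun _ : Fin n × Fin p => gaussianReal 0 1).map
        fun Z i => WithLp.toLp 2 (CFC.sqrt C *ᵥ fun j => Z (i, j)) := by
  have hcurry := Measure.infinitePi_map_curry (ι := Fin n) (κ := Fin p)
    (fun _ _ => gaussianReal 0 1)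
  simp only [Measure.infinitePi_eq_pi] at hcurry
  have h : ∀ i : Fin n, SigmaFinite ((Measure.pi fun _ : Fin p => gaussianReal 0 1).map
      fun g => WithLp.toLp 2 (CFC.sqrt C *ᵥ g)) := by
    intro i
    rw [← multivariateGaussian_eq_map_pi]
    infer_instance
  simp only [multivariateGaussian_eq_map_pi]
  rw [← Measure.pi_map_pi (by fun_prop), ← hcurry, Measure.map_map (by fun_prop) (by fun_prop)]
  rfl

/-- A sketched Gaussian design has full column rank almost surely. -/
lemma ae_det_design_ne_zero {n p k : ℕ} {C : Matrix (Fin p) (Fin p) ℝ} (hC : C.PosSemidef)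
    {S : Matrix (Fin p) (Fin k) ℝ} (hS : (Sᵀ * C * S).det ≠ 0) (hkn : k ≤ n) :
    ∀ᵐ x ∂(Measure.pi fun _ : Fin n => multivariateGaussian 0 C),
      ((designMatrix x * S)ᵀ * (designMatrix x * S)).det ≠ 0 := by
  set R : Matrix (Fin p) (Fin p) ℝ := CFC.sqrt C with hR
  have hRT : Rᵀ = R := by
    have := (CFC.sqrt_nonneg C).isSelfAdjoint
    rw [IsSelfAdjoint, Matrix.star_eq_conjTranspose] at this
    simpa using this
  have hRR : R * R = C := CFC.sqrt_mul_sqrt_self C hC.nonneg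
  have hA : (R * S)ᵀ * (R * S) = Sᵀ * C * S := by
    rw [Matrix.transpose_mul, hRT, ← hRR]
    simp only [Matrix.mul_assoc]
  have hcont : Continuous fun x : Fin n → EuclideanSpace ℝ (Fin p) =>
      ((designMatrix x * S)ᵀ * (designMatrix x * S)).det := by
    have h1 : Continuous fun x : Fin n → EuclideanSpace ℝ (Fin p) => designMatrix x :=
      continuous_matrix fun i j => by simp only [designMatrix, Matrix.of_apply]; fun_prop
    exact ((h1.matrix_mul continuous_const).matrix_transpose.matrix_mul
      (h1.matrix_mul continuous_const)).matrix_det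
  have hset : MeasurableSet {x : Fin n → EuclideanSpace ℝ (Fin p) |
      ((designMatrix x * S)ᵀ * (designMatrix x * S)).det ≠ 0} :=
    (hcont.measurable (measurableSet_singleton 0)).compl
  have hmeas : Measurable fun (Z : Fin n × Fin p → ℝ) (i : Fin n) =>
      WithLp.toLp 2 (R *ᵥ fun j => Z (i, j)) :=
    (continuous_pi fun i => (PiLp.continuous_toLp 2 _).comp
      (continuous_const.matrix_mulVec (by fun_prop))).measurable
  -- With `R = √C` the sketched design is `Z (R S)` for a matrix `Z` of independent standard
  -- normals, so its Gram determinant is a polynomial in `Z`.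
  rw [pi_multivariateGaussian_eq_map, ae_map_iff hmeas.aemeasurable hset]
  set Z : Matrix (Fin n) (Fin p) (MvPolynomial (Fin n × Fin p) ℝ) :=
    Matrix.of fun i j => MvPolynomial.X (i, j) with hZ
  set A' : Matrix (Fin p) (Fin k) (MvPolynomial (Fin n × Fin p) ℝ) :=
    (R * S).map MvPolynomial.C with hA'
  have hmap : ∀ x : Fin n × Fin p → ℝ,
      ((Z * A')ᵀ * (Z * A')).map (MvPolynomial.eval x) =
        ((Matrix.of fun i j => x (i, j)) * (R * S))ᵀ * ((Matrix.of fun i j => x (i, j)) * (R * S)) := by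
    intro x
    have h1 : Z.map (MvPolynomial.eval x) = Matrix.of fun i j => x (i, j) := by
      ext
      simp [hZ]
    have h2 : A'.map (MvPolynomial.eval x) = R * S := by
      ext
      rw [hA', Matrix.map_apply, Matrix.map_apply, MvPolynomial.eval_C]
    rw [Matrix.map_mul, Matrix.transpose_map, Matrix.map_mul, h1, h2]
  have hex : ∃ x : Fin n × Fin p → ℝ,
      (((Z * A')ᵀ * (Z * A')).map (MvPolynomial.eval x)).det ≠ 0 := by
    -- The witness `L` is `I` times a left inverse of `R S`, where `I` consists of the first `k`
    -- columns of the identity (this needs `k ≤ n`). Then `L (R S) = I` has Gram matrix 1.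
    set I : Matrix (Fin n) (Fin k) ℝ := (1 : Matrix (Fin n) (Fin n) ℝ).submatrix id (Fin.castLE hkn)
    have hI : Iᵀ * I = 1 := by
      rw [Matrix.transpose_submatrix, Matrix.transpose_one,
        ← Matrix.submatrix_mul _ _ _ id _ Function.bijective_id, Matrix.one_mul, Matrix.submatrix_one _ (Fin.castLE_injective hkn)]
    set L : Matrix (Fin n) (Fin p) ℝ := I * (((R * S)ᵀ * (R * S))⁻¹ * (R * S)ᵀ)
    have hL : L * (R * S) = I := by
      rw [Matrix.mul_assoc, Matrix.mul_assoc, Matrix.nonsing_inv_mul _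
        (isUnit_iff_ne_zero.2 (hA ▸ hS)), Matrix.mul_one]
    refine ⟨Function.uncurry L, ?_⟩
    rw [hmap]
    have : (Matrix.of fun i j => Function.uncurry L (i, j)) = L := rfl
    rw [this, hL, hI]
    simp
  have h := ae_det_ne_zero ((Z * A')ᵀ * (Z * A')) hex
  simp only [hmap] at h
  filter_upwards [h] with x hx
  have hdesign : designMatrix (fun i => WithLp.toLp 2 (R *ᵥ fun j => x (i, j))) * S =
      (Matrix.of fun i j => x (i, j)) * (R * S) := by
    rw [← Matrix.mul_assoc]
    congr 1
    ext i j
    conv_rhs => rw [← hRT]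
    simp [designMatrix, Matrix.mul_apply, Matrix.mulVec, dotProduct, mul_comm]
  rw [hdesign]
  exact hx

end Design

/-! ### Splitting one observation into independent parts -/

section RowLaw

open scoped RealInnerProductSpace

variable {p k : ℕ} {C : Matrix (Fin p) (Fin p) ℝ}

lemma covariance_inner_multivariateGaussian (hC : C.PosSemidef)
    (u v : EuclideanSpace ℝ (Fin p)) :
    cov[fun w => ⟪u, w⟫, fun w => ⟪v, w⟫; multivariateGaussian 0 C] =
      u.ofLp ⬝ᵥ (C *ᵥ v.ofLp) := by
  rw [← covarianceBilin_apply_eq_cov IsGaussian.memLp_two_id,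
    covarianceBilin_multivariateGaussian hC]

lemma memLp_inner_multivariateGaussian (u : EuclideanSpace ℝ (Fin p)) :
    MemLp (fun w => ⟪u, w⟫) 2 (multivariateGaussian 0 C) :=
  (IsGaussian.hasGaussianLaw_id.map_fun (innerSL ℝ u)).memLp_two

/-- A linear functional of a centred Gaussian vector. -/
lemma hasLaw_inner_multivariateGaussian (hC : C.PosSemidef) (u : EuclideanSpace ℝ (Fin p)) :
    HasLaw (fun w => ⟪u, w⟫) (gaussianReal 0 (u.ofLp ⬝ᵥ (C *ᵥ u.ofLp)).toNNReal)
      (multivariateGaussian 0 C) := by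
  refine ⟨by fun_prop, ?_⟩
  have h := (IsGaussian.hasGaussianLaw_id (μ := multivariateGaussian 0 C)).map_fun (innerSL ℝ u)
  have hmean : ∫ w, ⟪u, w⟫ ∂(multivariateGaussian 0 C) = 0 := by
    have h1 := (innerSL ℝ u).integral_comp_comm (φ := fun w => w)
      (IsGaussian.integrable_id (μ := multivariateGaussian 0 C))
    rw [integral_id_multivariateGaussian, map_zero] at h1
    exact h1
  have h2 := h.map_eq_gaussianReal
  simp only [innerSL_apply_apply, id_eq] at h2
  rw [h2, hmean, ← covariance_self (by fun_prop), covariance_inner_multivariateGaussian hC]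

/-- A row of the sketched design is independent of the part of the response that is
uncorrelated with it. -/
lemma hasLaw_row (hC : C.PosSemidef) {S : Matrix (Fin p) (Fin k) ℝ} {v : Fin p → ℝ}
    (hv : Sᵀ *ᵥ (C *ᵥ v) = 0) {σ s : ℝ} (hs : s ≠ 0) (hs2 : s ^ 2 = v ⬝ᵥ (C *ᵥ v) + σ ^ 2) :
    HasLaw (fun w : EuclideanSpace ℝ (Fin p) × ℝ =>
        (WithLp.toLp 2 (Sᵀ *ᵥ w.1.ofLp), s⁻¹ * (v ⬝ᵥ w.1.ofLp + σ * w.2)))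
      (((multivariateGaussian 0 C).map fun x => WithLp.toLp 2 (Sᵀ *ᵥ x.ofLp)).prod
        (gaussianReal 0 1)) ((multivariateGaussian 0 C).prod (gaussianReal 0 1)) := by
  set μ := (multivariateGaussian 0 C).prod (gaussianReal 0 1) with hμ
  set L₁ : EuclideanSpace ℝ (Fin p) →L[ℝ] EuclideanSpace ℝ (Fin k) :=
    (Matrix.toEuclideanLin Sᵀ).toContinuousLinearMap with hL₁
  set L₂ : EuclideanSpace ℝ (Fin p) × ℝ →L[ℝ] ℝ :=
    s⁻¹ • ((innerSL ℝ (WithLp.toLp 2 v)).comp (ContinuousLinearMap.fst ℝ _ _) +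
      σ • ContinuousLinearMap.snd ℝ _ _) with hL₂
  have hL₂' : ∀ w, L₂ w = s⁻¹ * (⟪WithLp.toLp 2 v, w.1⟫ + σ * w.2) := fun w => by simp [hL₂, mul_add]
  have hgauss : HasGaussianLaw (fun w => (L₁ w.1, L₂ w)) μ :=
    IsGaussian.hasGaussianLaw_id.map_fun
      ((L₁.comp (ContinuousLinearMap.fst ℝ _ _)).prod L₂)
  have hfst : ∀ u : EuclideanSpace ℝ (Fin p),
      MemLp (fun w : EuclideanSpace ℝ (Fin p) × ℝ => ⟪u, w.1⟫) 2 μ := fun u =>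
    (memLp_inner_multivariateGaussian u).comp_measurePreserving measurePreserving_fst
  have hsnd : MemLp (fun w : EuclideanSpace ℝ (Fin p) × ℝ => σ * w.2) 2 μ :=
    (IsGaussian.memLp_two_id.comp_measurePreserving measurePreserving_snd).const_mul σ
  have hind : ∀ u : EuclideanSpace ℝ (Fin p), IndepFun
      (fun w : EuclideanSpace ℝ (Fin p) × ℝ => ⟪u, w.1⟫) (fun w => σ * w.2) μ := fun u =>
    indepFun_prod (X := fun w => ⟪u, w⟫) (Y := fun x => σ * x) (by fun_prop) (by fun_prop)
  have hcov : ∀ u : EuclideanSpace ℝ (Fin p),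
      cov[fun w => ⟪u, w.1⟫, L₂; μ] = s⁻¹ * (u.ofLp ⬝ᵥ (C *ᵥ v)) := by
    intro u
    have h1 : (L₂ : EuclideanSpace ℝ (Fin p) × ℝ → ℝ) =
        fun w => s⁻¹ * ((fun w : EuclideanSpace ℝ (Fin p) × ℝ => ⟪WithLp.toLp 2 v, w.1⟫) +
          fun w : EuclideanSpace ℝ (Fin p) × ℝ => σ * w.2) w :=
      funext hL₂'
    rw [h1, covariance_const_mul_right, covariance_add_right (hfst u) (hfst _) hsnd,
      (hind u).covariance_eq_zero (hfst u) hsnd, add_zero]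
    congr 1
    rw [← covariance_inner_multivariateGaussian hC]
    exact (measurePreserving_fst.hasLaw).covariance_fun_comp (by fun_prop) (by fun_prop)
  -- Joint Gaussianity reduces independence to vanishing covariances, and the covariance with `aᵀ Sᵀ
  -- x` is a multiple of `(S a)ᵀ C v = aᵀ (Sᵀ C v) = 0`.
  have hindep : IndepFun (fun w : EuclideanSpace ℝ (Fin p) × ℝ => L₁ w.1) L₂ μ := by
    refine hgauss.indepFun_of_covariance_inner fun a b => ?_
    have h1 : (fun w : EuclideanSpace ℝ (Fin p) × ℝ => ⟪a, L₁ w.1⟫) =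
        fun w => ⟪WithLp.toLp 2 (S *ᵥ a.ofLp), w.1⟫ := by
      ext w
      rw [EuclideanSpace.inner_eq_star_dotProduct, EuclideanSpace.inner_eq_star_dotProduct]
      simp only [hL₁, star_trivial, LinearMap.coe_toContinuousLinearMap']
      rw [Matrix.toLpLin_apply, dotProduct_comm, Matrix.dotProduct_mulVec,
        Matrix.vecMul_transpose, dotProduct_comm]
    have h2 : (fun w => ⟪b, L₂ w⟫) = fun w => L₂ w * b := by
      ext w
      simp
    rw [h1, h2, covariance_mul_const_right, hcov]
    simp only
    rw [← Matrix.vecMul_transpose, ← Matrix.dotProduct_mulVec, hv]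
    simp
  have hlaw₁ : HasLaw (fun w : EuclideanSpace ℝ (Fin p) × ℝ => L₁ w.1)
      ((multivariateGaussian 0 C).map L₁) μ :=
    HasLaw.comp (Y := L₁) ⟨by fun_prop, rfl⟩ measurePreserving_fst.hasLaw
  have hlaw₂ : HasLaw L₂ (gaussianReal 0 1) μ := by
    refine ⟨by fun_prop, ?_⟩
    have hmean : ∫ w, L₂ w ∂μ = 0 := by
      have h1 := (hasLaw_inner_multivariateGaussian hC (WithLp.toLp 2 v)).comp
        (measurePreserving_fst (ν := gaussianReal 0 1)).hasLaw
      have h2 : ∫ w, ⟪WithLp.toLp 2 v, w.1⟫ ∂μ = 0 := by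
        simpa [integral_id_gaussianReal] using h1.integral_eq
      have h3 : ∫ w, w.2 ∂μ = 0 := by
        simpa [integral_id_gaussianReal] using (measurePreserving_snd
          (μ := multivariateGaussian 0 C) (ν := gaussianReal 0 1)).hasLaw.integral_eq
      simp only [hL₂']
      rw [integral_const_mul, integral_add ((hfst _).integrable (by norm_num))
        (hsnd.integrable (by norm_num)), integral_const_mul, h2, h3]
      simp
    have hvar : Var[L₂; μ] = 1 := by
      have h1 : Var[fun w : EuclideanSpace ℝ (Fin p) × ℝ => ⟪WithLp.toLp 2 v, w.1⟫; μ] =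
          v ⬝ᵥ (C *ᵥ v) := by
        rw [← covariance_self (by fun_prop), ← covariance_inner_multivariateGaussian hC
          (WithLp.toLp 2 v) (WithLp.toLp 2 v)]
        exact (measurePreserving_fst.hasLaw).covariance_fun_comp (by fun_prop) (by fun_prop)
      have h2 : Var[fun w : EuclideanSpace ℝ (Fin p) × ℝ => σ * w.2; μ] = σ ^ 2 := by
        rw [variance_const_mul, (measurePreserving_snd (μ := multivariateGaussian 0 C)
          (ν := gaussianReal 0 1)).hasLaw.variance_eq]
        simp
      have h3 : (L₂ : EuclideanSpace ℝ (Fin p) × ℝ → ℝ) =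
          fun w => s⁻¹ * ((fun w : EuclideanSpace ℝ (Fin p) × ℝ => ⟪WithLp.toLp 2 v, w.1⟫) +
            fun w : EuclideanSpace ℝ (Fin p) × ℝ => σ * w.2) w := funext hL₂'
      rw [h3, variance_const_mul, (hind _).variance_add (hfst _) hsnd, h1, h2, ← hs2]
      field_simp
    have h := hgauss.snd.map_eq_gaussianReal
    rw [h, hmean, hvar]
    simp
  have h := (indepFun_iff_hasLaw_prodMk_prod hlaw₁ hlaw₂).1 hindep
  have h1 : ∀ w, L₁ w = WithLp.toLp 2 (Sᵀ *ᵥ w.ofLp) := fun w => rfl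
  have h2 : ∀ w : EuclideanSpace ℝ (Fin p), ⟪WithLp.toLp 2 v, w⟫ = v ⬝ᵥ w.ofLp := fun w => by
    rw [EuclideanSpace.inner_eq_star_dotProduct, star_trivial, dotProduct_comm]
  simp only [hL₂', h2] at h
  exact h

end RowLaw

/-! ### The population regression on the sketched covariates -/

section LinearAlgebra

variable {p k : ℕ} {C : Matrix (Fin p) (Fin p) ℝ} {S : Matrix (Fin p) (Fin k) ℝ}

/-- The coefficients of the population regression on the sketched covariates. -/
noncomputable def sketchedCoeff (C : Matrix (Fin p) (Fin p) ℝ) (β : Fin p → ℝ)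
    (S : Matrix (Fin p) (Fin k) ℝ) : Fin k → ℝ :=
  (Sᵀ * C * S)⁻¹ *ᵥ (Sᵀ *ᵥ (C *ᵥ β))

/-- These are the normal equations of the population regression. They supply the hypothesis of
`hasLaw_row` under which the unexplained response is independent of the sketched design. -/
lemma transpose_mulVec_residual_eq_zero (hS : (Sᵀ * C * S).det ≠ 0) (β : Fin p → ℝ) :
    Sᵀ *ᵥ (C *ᵥ (β - S *ᵥ sketchedCoeff C β S)) = 0 := by
  rw [Matrix.mulVec_sub, Matrix.mulVec_sub, sub_eq_zero]
  conv_rhs => rw [Matrix.mulVec_mulVec, Matrix.mulVec_mulVec, sketchedCoeff,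
    Matrix.mulVec_mulVec, Matrix.mul_nonsing_inv _ (isUnit_iff_ne_zero.2 hS), Matrix.one_mulVec]

lemma dotProduct_mulVec_comm_of_posSemidef (hC : C.PosSemidef) (u v : Fin p → ℝ) :
    u ⬝ᵥ (C *ᵥ v) = v ⬝ᵥ (C *ᵥ u) := by
  have h : Cᵀ = C := by simpa using hC.isHermitian.eq
  rw [dotProduct_comm, Matrix.dotProduct_mulVec v, ← Matrix.mulVec_transpose, h]

lemma deltaSq_eq_dotProduct_sketchedCoeff (hC : C.PosSemidef) (β : Fin p → ℝ) :
    deltaSq C β S = (S *ᵥ sketchedCoeff C β S) ⬝ᵥ (C *ᵥ β) := by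
  rw [dotProduct_mulVec_comm_of_posSemidef hC]
  simp [deltaSq, sketchedCoeff, Matrix.mul_assoc]

lemma dotProduct_residual_eq_zero (hS : (Sᵀ * C * S).det ≠ 0) (β : Fin p → ℝ) (u : Fin k → ℝ) :
    (S *ᵥ u) ⬝ᵥ (C *ᵥ (β - S *ᵥ sketchedCoeff C β S)) = 0 := by
  rw [← Matrix.vecMul_transpose, ← Matrix.dotProduct_mulVec,
    transpose_mulVec_residual_eq_zero hS, dotProduct_zero]

/-- `S γ` is the projection of `β` onto the range of `S` for the form `C`, so `Δ²` is the variance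
explained by the sketched covariates. -/
lemma deltaSq_eq_quadratic (hC : C.PosSemidef) (hS : (Sᵀ * C * S).det ≠ 0) (β : Fin p → ℝ) :
    deltaSq C β S =
      (S *ᵥ sketchedCoeff C β S) ⬝ᵥ (C *ᵥ (S *ᵥ sketchedCoeff C β S)) := by
  have h := dotProduct_residual_eq_zero hS β (sketchedCoeff C β S)
  rw [Matrix.mulVec_sub, dotProduct_sub] at h
  rw [deltaSq_eq_dotProduct_sketchedCoeff hC]
  linarith

/-- Pythagoras for the form `C`: total variance splits into explained and residual variance. -/
lemma quadratic_residual (hC : C.PosSemidef) (hS : (Sᵀ * C * S).det ≠ 0) (β : Fin p → ℝ) :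
    (β - S *ᵥ sketchedCoeff C β S) ⬝ᵥ (C *ᵥ (β - S *ᵥ sketchedCoeff C β S)) =
      β ⬝ᵥ (C *ᵥ β) - deltaSq C β S := by
  rw [sub_dotProduct, dotProduct_residual_eq_zero hS, Matrix.mulVec_sub, dotProduct_sub,
    deltaSq_eq_dotProduct_sketchedCoeff hC, sub_zero,
    dotProduct_mulVec_comm_of_posSemidef hC (S *ᵥ _) β]

lemma dotProduct_mulVec_self_nonneg (hC : C.PosSemidef) (u : Fin p → ℝ) :
    0 ≤ u ⬝ᵥ (C *ᵥ u) := by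
  simpa using hC.dotProduct_mulVec_nonneg u

lemma deltaSq_nonneg (hC : C.PosSemidef) (β : Fin p → ℝ) : 0 ≤ deltaSq C β S := by
  by_cases hS : (Sᵀ * C * S).det = 0
  · have h : (Sᵀ * C * S)⁻¹ = 0 := Matrix.nonsing_inv_apply_not_isUnit _ (by simp [hS])
    simp [deltaSq, h]
  · rw [deltaSq_eq_quadratic hC hS]
    exact dotProduct_mulVec_self_nonneg hC _

/-- Nonnegativity of the residual variance. A singular `Sᵀ C S` has inverse zero by convention, so
`Δ² = 0` and the bound holds for every sketch. -/
lemma deltaSq_le (hC : C.PosSemidef) (β : Fin p → ℝ) :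
    deltaSq C β S ≤ β ⬝ᵥ (C *ᵥ β) := by
  by_cases hS : (Sᵀ * C * S).det = 0
  · have h : (Sᵀ * C * S)⁻¹ = 0 := Matrix.nonsing_inv_apply_not_isUnit _ (by simp [hS])
    simpa [deltaSq, h] using dotProduct_mulVec_self_nonneg hC β
  · have h := quadratic_residual hC hS β
    have := dotProduct_mulVec_self_nonneg hC (β - S *ᵥ sketchedCoeff C β S)
    linarith

end LinearAlgebra

/-! ### Joint law of the sketched design and the effective noise -/

section Design

variable {n p k : ℕ} {C : Matrix (Fin p) (Fin p) ℝ}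

lemma measurePreserving_ofLp_stdGaussian (n : ℕ) :
    MeasurePreserving (fun e : EuclideanSpace ℝ (Fin n) => e.ofLp)
      (stdGaussian (EuclideanSpace ℝ (Fin n))) (Measure.pi fun _ => gaussianReal 0 1) := by
  refine ⟨by fun_prop, ?_⟩
  rw [← map_pi_eq_stdGaussian, Measure.map_map (by fun_prop) (by fun_prop)]
  exact Measure.map_id

lemma measurePreserving_toLp_stdGaussian (n : ℕ) :
    MeasurePreserving (WithLp.toLp 2 : (Fin n → ℝ) → EuclideanSpace ℝ (Fin n))
      (Measure.pi fun _ => gaussianReal 0 1) (stdGaussian (EuclideanSpace ℝ (Fin n))) :=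
  ⟨by fun_prop, map_pi_eq_stdGaussian⟩

/-- The sketched design and the standardised part of the response not explained by it. -/
noncomputable def sketchedSample (S : Matrix (Fin p) (Fin k) ℝ) (v : Fin p → ℝ) (σ s : ℝ)
    (q : (Fin n → EuclideanSpace ℝ (Fin p)) × EuclideanSpace ℝ (Fin n)) :
    (Fin n → EuclideanSpace ℝ (Fin k)) × EuclideanSpace ℝ (Fin n) :=
  (fun i => WithLp.toLp 2 (Sᵀ *ᵥ (q.1 i).ofLp),
    WithLp.toLp 2 fun i => s⁻¹ * (v ⬝ᵥ (q.1 i).ofLp + σ * q.2 i))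

/-- The law of a row of the sketched design. -/
noncomputable def sketchedRow (C : Matrix (Fin p) (Fin p) ℝ) (S : Matrix (Fin p) (Fin k) ℝ) :
    Measure (EuclideanSpace ℝ (Fin k)) :=
  (multivariateGaussian 0 C).map fun x => WithLp.toLp 2 (Sᵀ *ᵥ x.ofLp)

lemma measurable_toLp_mulVec (A : Matrix (Fin k) (Fin p) ℝ) :
    Measurable fun x : EuclideanSpace ℝ (Fin p) =>
      (WithLp.toLp 2 (A *ᵥ x.ofLp) : EuclideanSpace ℝ (Fin k)) :=
  (Matrix.toEuclideanLin A).toContinuousLinearMap.measurable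

instance isProbabilityMeasure_sketchedRow (S : Matrix (Fin p) (Fin k) ℝ) :
    IsProbabilityMeasure (sketchedRow C S) :=
  Measure.isProbabilityMeasure_map (measurable_toLp_mulVec _).aemeasurable

/-- The row statement holds independently in every row; the rest regroups a pair of arrays as an
array of pairs and back. -/
lemma measurePreserving_sketchedSample (hC : C.PosSemidef) {S : Matrix (Fin p) (Fin k) ℝ}
    {v : Fin p → ℝ} (hv : Sᵀ *ᵥ (C *ᵥ v) = 0) {σ s : ℝ} (hs : s ≠ 0)
    (hs2 : s ^ 2 = v ⬝ᵥ (C *ᵥ v) + σ ^ 2) :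
    MeasurePreserving (sketchedSample S v σ s)
      ((Measure.pi fun _ : Fin n => multivariateGaussian 0 C).prod
        (stdGaussian (EuclideanSpace ℝ (Fin n))))
      ((Measure.pi fun _ : Fin n => sketchedRow C S).prod
        (stdGaussian (EuclideanSpace ℝ (Fin n)))) := by
  have hrow : MeasurePreserving (fun w : EuclideanSpace ℝ (Fin p) × ℝ =>
        ((WithLp.toLp 2 (Sᵀ *ᵥ w.1.ofLp) : EuclideanSpace ℝ (Fin k)),
          s⁻¹ * (v ⬝ᵥ w.1.ofLp + σ * w.2)))
      ((multivariateGaussian 0 C).prod (gaussianReal 0 1))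
      ((sketchedRow C S).prod (gaussianReal 0 1)) := by
    refine ⟨?_, (hasLaw_row hC hv hs hs2).map_eq⟩
    refine ((measurable_toLp_mulVec _).comp measurable_fst).prodMk ?_
    have : Measurable fun w : EuclideanSpace ℝ (Fin p) => v ⬝ᵥ w.ofLp := by
      unfold dotProduct
      fun_prop
    exact (((this.comp measurable_fst).add (measurable_snd.const_mul σ)).const_mul s⁻¹)
  have h1 := (MeasurePreserving.id (Measure.pi fun _ : Fin n => multivariateGaussian 0 C)).prod
    (measurePreserving_ofLp_stdGaussian n)
  have h2 := (measurePreserving_arrowProdEquivProdArrow (EuclideanSpace ℝ (Fin p)) ℝ (Fin n)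
    (fun _ => multivariateGaussian 0 C) fun _ => gaussianReal 0 1).symm
  have h3 := measurePreserving_pi (fun _ : Fin n => (multivariateGaussian 0 C).prod
    (gaussianReal 0 1)) (fun _ => (sketchedRow C S).prod (gaussianReal 0 1)) fun _ => hrow
  have h4 := measurePreserving_arrowProdEquivProdArrow (EuclideanSpace ℝ (Fin k)) ℝ (Fin n)
    (fun _ => sketchedRow C S) fun _ => gaussianReal 0 1
  have h5 := (MeasurePreserving.id (Measure.pi fun _ : Fin n => sketchedRow C S)).prod
    (measurePreserving_toLp_stdGaussian n)
  exact h5.comp (h4.comp (h3.comp (h2.comp h1)))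

/-- A conditional law that does not depend on the condition is the unconditional law. It is used
with the sketched design as the condition. -/
lemma hasLaw_of_ae_map_eq {α β γ : Type*} [MeasurableSpace α] [MeasurableSpace β]
    [MeasurableSpace γ] {μ : Measure α} {ν : Measure β} {ξ : Measure γ} [IsProbabilityMeasure μ]
    [SFinite ν] {f : α × β → γ} (hf : Measurable f)
    (h : ∀ᵐ a ∂μ, ν.map (fun b => f (a, b)) = ξ) : HasLaw f ξ (μ.prod ν) := by
  refine ⟨hf.aemeasurable, Measure.ext fun s hs => ?_⟩
  rw [Measure.map_apply hf hs, Measure.prod_apply (hf hs)]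
  have h1 : ∀ᵐ a ∂μ, ν (Prod.mk a ⁻¹' (f ⁻¹' s)) = ξ s := by
    filter_upwards [h] with a ha
    rw [← ha, Measure.map_apply (f := fun b => f (a, b)) (hf.comp measurable_prodMk_left) hs]
    rfl
  rw [lintegral_congr_ae h1, lintegral_const, measure_univ, mul_one]

lemma designMatrix_toLp_mulVec (S : Matrix (Fin p) (Fin k) ℝ)
    (x : Fin n → EuclideanSpace ℝ (Fin p)) :
    designMatrix (fun i => WithLp.toLp 2 (Sᵀ *ᵥ (x i).ofLp)) = designMatrix x * S := by
  ext i j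
  simp [designMatrix, Matrix.mulVec, dotProduct, Matrix.mul_apply, mul_comm]

lemma continuous_designMatrix :
    Continuous fun w : Fin n → EuclideanSpace ℝ (Fin k) => designMatrix w := by
  refine continuous_matrix fun i j => ?_
  simp only [designMatrix, Matrix.of_apply]
  fun_prop

lemma ae_det_sketchedRow_ne_zero (hC : C.PosSemidef) {S : Matrix (Fin p) (Fin k) ℝ}
    (hS : (Sᵀ * C * S).det ≠ 0) (hkn : k ≤ n) :
    ∀ᵐ w ∂(Measure.pi fun _ : Fin n => sketchedRow C S),
      ((designMatrix w)ᵀ * designMatrix w).det ≠ 0 := by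
  have h := measurePreserving_pi (fun _ : Fin n => multivariateGaussian 0 C)
    (fun _ => sketchedRow C S) fun _ => ⟨measurable_toLp_mulVec Sᵀ, rfl⟩
  rw [← h.map_eq, ae_map_iff h.aemeasurable]
  · filter_upwards [ae_det_design_ne_zero hC hS hkn] with x hx
    rwa [designMatrix_toLp_mulVec]
  · have : Continuous fun w : Fin n → EuclideanSpace ℝ (Fin k) =>
        ((designMatrix w)ᵀ * designMatrix w).det :=
      (continuous_designMatrix.matrix_transpose.matrix_mul continuous_designMatrix).matrix_det
    exact (measurableSet_singleton 0).compl.preimage this.measurable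

lemma measurable_matrix_mul_apply {Ω ι κ τ : Type*} [MeasurableSpace Ω] [Fintype κ]
    {A : Ω → Matrix ι κ ℝ} {B : Ω → Matrix κ τ ℝ} (hA : ∀ i j, Measurable fun ω => A ω i j)
    (hB : ∀ i j, Measurable fun ω => B ω i j) (i : ι) (j : τ) :
    Measurable fun ω => (A ω * B ω) i j := by
  simp only [Matrix.mul_apply]
  exact Finset.measurable_fun_sum _ fun l _ => (hA i l).mul (hB l j)

lemma measurable_hatMatrix_quadratic :
    Measurable fun q : (Fin n → EuclideanSpace ℝ (Fin k)) × EuclideanSpace ℝ (Fin n) =>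
      q.2.ofLp ⬝ᵥ (hatMatrix (designMatrix q.1) *ᵥ q.2.ofLp) := by
  have hG : Continuous fun w : Fin n → EuclideanSpace ℝ (Fin k) =>
      (designMatrix w)ᵀ * designMatrix w :=
    continuous_designMatrix.matrix_transpose.matrix_mul continuous_designMatrix
  have hinv : ∀ i j, Measurable fun q :
      (Fin n → EuclideanSpace ℝ (Fin k)) × EuclideanSpace ℝ (Fin n) =>
      ((designMatrix q.1)ᵀ * designMatrix q.1)⁻¹ i j := by
    intro i j
    simp only [Matrix.inv_def, Ring.inverse_eq_inv', Matrix.smul_apply, smul_eq_mul]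
    exact (hG.matrix_det.measurable.inv.mul
      (hG.matrix_adjugate.matrix_elem i j).measurable).comp measurable_fst
  have hD : ∀ i j, Measurable fun q :
      (Fin n → EuclideanSpace ℝ (Fin k)) × EuclideanSpace ℝ (Fin n) => designMatrix q.1 i j :=
    fun i j => (continuous_designMatrix.matrix_elem i j).measurable.comp measurable_fst
  have hH : ∀ i j, Measurable fun q :
      (Fin n → EuclideanSpace ℝ (Fin k)) × EuclideanSpace ℝ (Fin n) =>
      hatMatrix (designMatrix q.1) i j :=
    measurable_matrix_mul_apply (B := fun q :
      (Fin n → EuclideanSpace ℝ (Fin k)) × EuclideanSpace ℝ (Fin n) => (designMatrix q.1)ᵀ)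
      (measurable_matrix_mul_apply hD hinv) fun i j => hD j i
  have he : ∀ i, Measurable fun q :
      (Fin n → EuclideanSpace ℝ (Fin k)) × EuclideanSpace ℝ (Fin n) => q.2 i := fun i => by
    fun_prop
  refine Finset.measurable_fun_sum _ fun i _ => (he i).mul ?_
  simp only [Matrix.mulVec, dotProduct]
  exact Finset.measurable_fun_sum _ fun j _ => (hH i j).mul (he j)

lemma hasLaw_dotProduct_sketchedRow (hC : C.PosSemidef) (S : Matrix (Fin p) (Fin k) ℝ)
    (γ : Fin k → ℝ) :
    HasLaw (fun w => γ ⬝ᵥ w.ofLp)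
      (gaussianReal 0 ((S *ᵥ γ) ⬝ᵥ (C *ᵥ (S *ᵥ γ))).toNNReal) (sketchedRow C S) := by
  have hm : Measurable fun w : EuclideanSpace ℝ (Fin k) => γ ⬝ᵥ w.ofLp := by
    unfold dotProduct
    fun_prop
  refine ⟨hm.aemeasurable, ?_⟩
  rw [sketchedRow, Measure.map_map hm (measurable_toLp_mulVec _),
    ← (hasLaw_inner_multivariateGaussian hC (WithLp.toLp 2 (S *ᵥ γ))).map_eq]
  congr 1
  ext x
  rw [EuclideanSpace.inner_eq_star_dotProduct, star_trivial, dotProduct_comm,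
    ← Matrix.vecMul_transpose, ← Matrix.dotProduct_mulVec]
  rfl

lemma hasLaw_hatMatrix_sketchedRow (hC : C.PosSemidef) {S : Matrix (Fin p) (Fin k) ℝ}
    (hS : (Sᵀ * C * S).det ≠ 0) (hkn : k ≤ n) :
    HasLaw (fun q : (Fin n → EuclideanSpace ℝ (Fin k)) × EuclideanSpace ℝ (Fin n) =>
        ((q.2.ofLp ⬝ᵥ (hatMatrix (designMatrix q.1) *ᵥ q.2.ofLp),
          q.2.ofLp ⬝ᵥ q.2.ofLp -
            q.2.ofLp ⬝ᵥ (hatMatrix (designMatrix q.1) *ᵥ q.2.ofLp)) : ℝ × ℝ))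
      ((chiSquared k).prod (chiSquared (n - k)))
      ((Measure.pi fun _ : Fin n => sketchedRow C S).prod
        (stdGaussian (EuclideanSpace ℝ (Fin n)))) := by
  refine hasLaw_of_ae_map_eq ?_ ?_
  · have : Measurable fun q : (Fin n → EuclideanSpace ℝ (Fin k)) × EuclideanSpace ℝ (Fin n) =>
        q.2.ofLp ⬝ᵥ q.2.ofLp := by
      unfold dotProduct
      fun_prop
    exact measurable_hatMatrix_quadratic.prodMk (this.sub measurable_hatMatrix_quadratic)
  · filter_upwards [ae_det_sketchedRow_ne_zero hC hS hkn] with w hw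
    exact (hasLaw_hatMatrix _ hw).map_eq

/-- The squared norm of the signal is a multiple of a chi-squared variable. -/
lemma exists_hasLaw_chiSquared_signal (hC : C.PosSemidef) (S : Matrix (Fin p) (Fin k) ℝ)
    (γ : Fin k → ℝ) :
    ∃ M : (Fin n → EuclideanSpace ℝ (Fin k)) × EuclideanSpace ℝ (Fin n) → ℝ,
      HasLaw M (chiSquared n) ((Measure.pi fun _ : Fin n => sketchedRow C S).prod
        (stdGaussian (EuclideanSpace ℝ (Fin n)))) ∧
      ∀ᵐ q ∂((Measure.pi fun _ : Fin n => sketchedRow C S).prod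
        (stdGaussian (EuclideanSpace ℝ (Fin n)))),
        (designMatrix q.1 *ᵥ γ) ⬝ᵥ (designMatrix q.1 *ᵥ γ) =
          ((S *ᵥ γ) ⬝ᵥ (C *ᵥ (S *ᵥ γ))) * M q := by
  set d := (S *ᵥ γ) ⬝ᵥ (C *ᵥ (S *ᵥ γ)) with hd
  have hd0 : 0 ≤ d := dotProduct_mulVec_self_nonneg hC _
  have hlaw := hasLaw_dotProduct_sketchedRow hC S γ
  rw [← hd] at hlaw
  have hrow : ∀ (w : Fin n → EuclideanSpace ℝ (Fin k)) i,
      (designMatrix w *ᵥ γ) i = γ ⬝ᵥ (w i).ofLp := fun w i => dotProduct_comm _ _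
  have hm : Measurable fun w : EuclideanSpace ℝ (Fin k) => γ ⬝ᵥ w.ofLp := by
    unfold dotProduct
    fun_prop
  have hchi : HasLaw (fun x : Fin n → ℝ => ∑ i, x i ^ 2) (chiSquared n)
      (Measure.pi fun _ : Fin n => gaussianReal 0 1) := ⟨measurable_sum_sq.aemeasurable, rfl⟩
  -- If `d = 0` the signal vanishes almost surely and any chi-squared variable serves as `M`, here
  -- the squared norm of the noise. Otherwise the signal coordinates are standardised by `√d`.
  rcases hd0.eq_or_lt with h0 | hpos
  · refine ⟨fun q => ∑ i, q.2 i ^ 2, ?_, ?_⟩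
    · exact hchi.comp ((measurePreserving_ofLp_stdGaussian n).comp measurePreserving_snd).hasLaw
    · rw [← h0, Real.toNNReal_zero, gaussianReal_zero_var] at hlaw
      have h1 : ∀ᵐ w ∂(sketchedRow C S), γ ⬝ᵥ w.ofLp = 0 := by
        have : ∀ᵐ y ∂((sketchedRow C S).map fun w => γ ⬝ᵥ w.ofLp), y = 0 := by
          rw [hlaw.map_eq]
          exact (ae_dirac_iff (p := fun y : ℝ => y = 0) (measurableSet_singleton 0)).2 rfl
        exact ae_of_ae_map hm.aemeasurable this
      have h2 : ∀ᵐ w ∂(Measure.pi fun _ : Fin n => sketchedRow C S), ∀ i, γ ⬝ᵥ (w i).ofLp = 0 :=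
        ae_all_iff.2 fun i => (measurePreserving_eval (fun _ : Fin n => sketchedRow C S)
          i).quasiMeasurePreserving.ae h1
      filter_upwards [measurePreserving_fst.quasiMeasurePreserving.ae h2] with q hq
      have h3 : designMatrix q.1 *ᵥ γ = 0 := funext fun i => by rw [hrow, hq]; rfl
      rw [h3, ← h0]
      simp
  · have hstd : MeasurePreserving (fun w : EuclideanSpace ℝ (Fin k) => (√d)⁻¹ * γ ⬝ᵥ w.ofLp)
        (sketchedRow C S) (gaussianReal 0 1) := by
      refine ⟨hm.const_mul _, ?_⟩
      have h1 := gaussianReal_map_const_mul (μ := 0) (v := d.toNNReal) (√d)⁻¹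
      rw [← hlaw.map_eq, Measure.map_map (measurable_const_mul _) hm] at h1
      refine h1.trans ?_
      rw [mul_zero]
      congr 1
      ext
      push_cast
      rw [Real.coe_toNNReal _ hd0, inv_pow, Real.sq_sqrt hd0]
      exact inv_mul_cancel₀ hpos.ne'
    have hpi := measurePreserving_pi (fun _ : Fin n => sketchedRow C S)
      (fun _ => gaussianReal 0 1) fun _ => hstd
    refine ⟨fun q => ∑ i, ((√d)⁻¹ * γ ⬝ᵥ (q.1 i).ofLp) ^ 2,
      hchi.comp (hpi.comp measurePreserving_fst).hasLaw, ae_of_all _ fun q => ?_⟩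
    rw [Finset.mul_sum]
    refine Finset.sum_congr rfl fun i _ => ?_
    rw [hrow, mul_pow, inv_pow, Real.sq_sqrt hd0]
    field_simp

lemma measurableSet_noise_signal (γ : Fin k → ℝ) (s δ : ℝ) :
    MeasurableSet {q : (Fin n → EuclideanSpace ℝ (Fin k)) × EuclideanSpace ℝ (Fin n) |
      δ < |s⁻¹ * (q.2.ofLp ⬝ᵥ (designMatrix q.1 *ᵥ γ))|} := by
  have hc : Continuous fun w : Fin n → EuclideanSpace ℝ (Fin k) => designMatrix w *ᵥ γ :=
    continuous_designMatrix.matrix_mulVec continuous_const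
  have h : Continuous fun q : (Fin n → EuclideanSpace ℝ (Fin k)) × EuclideanSpace ℝ (Fin n) =>
      q.2.ofLp ⬝ᵥ (designMatrix q.1 *ᵥ γ) :=
    Continuous.dotProduct (by fun_prop) (hc.comp continuous_fst)
  exact measurableSet_lt measurable_const (continuous_const.mul h).abs.measurable

/-- Tail bound for the product of the noise and the signal. -/
lemma measureReal_noise_signal_le (hC : C.PosSemidef) (S : Matrix (Fin p) (Fin k) ℝ)
    (γ : Fin k → ℝ) {s δ : ℝ} (hδ : 0 < δ) :
    ((Measure.pi fun _ : Fin n => sketchedRow C S).prod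
        (stdGaussian (EuclideanSpace ℝ (Fin n)))).real
      {q | δ < |s⁻¹ * (q.2.ofLp ⬝ᵥ (designMatrix q.1 *ᵥ γ))|} ≤
      n * (((S *ᵥ γ) ⬝ᵥ (C *ᵥ (S *ᵥ γ))) / s ^ 2) / δ ^ 2 := by
  set d := (S *ᵥ γ) ⬝ᵥ (C *ᵥ (S *ᵥ γ)) with hd
  have hd0 : 0 ≤ d := dotProduct_mulVec_self_nonneg hC _
  set N : (Fin n → EuclideanSpace ℝ (Fin k)) → ℝ := fun w =>
    (designMatrix w *ᵥ γ) ⬝ᵥ (designMatrix w *ᵥ γ) with hN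
  have hc : Continuous fun w : Fin n → EuclideanSpace ℝ (Fin k) => designMatrix w *ᵥ γ :=
    continuous_designMatrix.matrix_mulVec continuous_const
  have hNm : Measurable N := (hc.dotProduct hc).measurable
  obtain ⟨M, hM, hMN⟩ := exists_hasLaw_chiSquared_signal (n := n) hC S γ
  have hNint : ∫⁻ w, ENNReal.ofReal (N w) ∂(Measure.pi fun _ : Fin n => sketchedRow C S) =
      ENNReal.ofReal (d * n) := by
    have h1 : Integrable M ((Measure.pi fun _ : Fin n => sketchedRow C S).prod
        (stdGaussian (EuclideanSpace ℝ (Fin n)))) := by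
      have h2 : Integrable (fun x : ℝ => x) (chiSquared n) :=
        (memLp_id_chiSquared n).integrable (by norm_num)
      rw [← hM.map_eq] at h2
      exact h2.comp_aemeasurable hM.aemeasurable
    rw [← measurePreserving_fst (ν := stdGaussian (EuclideanSpace ℝ (Fin n))).lintegral_comp
      (by fun_prop), lintegral_congr_ae (hMN.mono fun q hq => congrArg ENNReal.ofReal hq),
      ← ofReal_integral_eq_lintegral_ofReal (h1.const_mul d), integral_const_mul,
      hM.integral_eq, integral_id_chiSquared]
    filter_upwards [hMN] with q hq
    rw [Pi.zero_apply, ← hq]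
    exact Finset.sum_nonneg fun i _ => mul_self_nonneg _
  -- For a fixed design the cross term is centred Gaussian with variance `N w / s²`, so Chebyshev
  -- applies; integrating over the design uses that the mean of `N` is `d n`.
  have hfib : ∀ w : Fin n → EuclideanSpace ℝ (Fin k), stdGaussian (EuclideanSpace ℝ (Fin n))
      {e | δ < |s⁻¹ * (e.ofLp ⬝ᵥ (designMatrix w *ᵥ γ))|} ≤
        ENNReal.ofReal (1 / (s ^ 2 * δ ^ 2)) * ENNReal.ofReal (N w) := by
    intro w
    set u : EuclideanSpace ℝ (Fin n) := WithLp.toLp 2 (designMatrix w *ᵥ γ) with hu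
    have h1 := hasLaw_inner_multivariateGaussian (C := (1 : Matrix (Fin n) (Fin n) ℝ))
      Matrix.PosSemidef.one u
    rw [multivariateGaussian_zero_one, Matrix.one_mulVec] at h1
    have h2 : ∀ e : EuclideanSpace ℝ (Fin n), e.ofLp ⬝ᵥ (designMatrix w *ᵥ γ) = inner ℝ u e :=
      fun e => by rw [EuclideanSpace.inner_eq_star_dotProduct, star_trivial]
    have hLp : MemLp (fun e : EuclideanSpace ℝ (Fin n) => s⁻¹ * inner ℝ u e) 2
        (stdGaussian (EuclideanSpace ℝ (Fin n))) := by
      rw [← multivariateGaussian_zero_one]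
      exact (memLp_inner_multivariateGaussian u).const_mul s⁻¹
    have hmean : ∫ e, s⁻¹ * inner ℝ u e ∂(stdGaussian (EuclideanSpace ℝ (Fin n))) = 0 := by
      rw [integral_const_mul, h1.integral_eq]
      simp
    have hvar : Var[fun e : EuclideanSpace ℝ (Fin n) => s⁻¹ * inner ℝ u e;
        stdGaussian (EuclideanSpace ℝ (Fin n))] = (s ^ 2)⁻¹ * N w := by
      rw [variance_const_mul, h1.variance_eq, inv_pow]
      congr 1
      refine variance_id_gaussianReal.trans ?_
      exact Real.coe_toNNReal _ (Finset.sum_nonneg fun i _ => mul_self_nonneg _)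
    have h3 := meas_ge_le_variance_div_sq hLp hδ
    rw [hmean, hvar] at h3
    simp only [sub_zero] at h3
    rw [← ENNReal.ofReal_mul (by positivity)]
    simp only [h2]
    have h4 : {e : EuclideanSpace ℝ (Fin n) | δ < |s⁻¹ * inner ℝ u e|} ⊆
        {e | δ ≤ |s⁻¹ * inner ℝ u e|} := Set.ofPred_subset_ofPred.2 fun e => le_of_lt
    refine (measure_mono h4).trans (h3.trans_eq ?_)
    congr 1
    rw [one_div, mul_inv, div_eq_mul_inv]
    ring
  refine ENNReal.toReal_le_of_le_ofReal (by positivity) ?_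
  rw [Measure.prod_apply (measurableSet_noise_signal γ s δ)]
  refine (lintegral_mono hfib).trans ?_
  rw [lintegral_const_mul _ (by fun_prop), hNint, ← ENNReal.ofReal_mul (by positivity)]
  exact ENNReal.ofReal_le_ofReal (le_of_eq (by field_simp))

end Design

/-! ### Exact finite-sample decomposition of the statistic -/

section FiniteSample

variable {Ω : Type*} [MeasurableSpace Ω] {P : Measure Ω} [IsProbabilityMeasure P] {n p k : ℕ}
  {C : Matrix (Fin p) (Fin p) ℝ} {x : Ω → Fin n → EuclideanSpace ℝ (Fin p)}
  {z : Ω → EuclideanSpace ℝ (Fin n)}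

lemma IsGaussianDesign.hasLaw_prodMk (hx : IsGaussianDesign P x C)
    (hz : HasLaw z (multivariateGaussian 0 1) P) (hxz : IndepFun x z P) :
    HasLaw (fun ω => (x ω, z ω)) ((Measure.pi fun _ : Fin n => multivariateGaussian 0 C).prod
      (stdGaussian (EuclideanSpace ℝ (Fin n)))) P := by
  rw [multivariateGaussian_zero_one] at hz
  exact hxz.hasLaw_prod (hx.indep.hasLaw_pi hx.law) hz

/-- The part `X S γ` is split off from `X β`; the remainder `X (β - S γ) + σ z` is the effective
noise, standardised by `s`. -/
lemma response_eq (S : Matrix (Fin p) (Fin k) ℝ) (β : Fin p → ℝ) (γ : Fin k → ℝ) (σ : ℝ) {s : ℝ}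
    (hs : s ≠ 0) (x : Fin n → EuclideanSpace ℝ (Fin p)) (z : EuclideanSpace ℝ (Fin n)) :
    response x β σ z = (designMatrix x * S) *ᵥ γ +
      s • (sketchedSample S (β - S *ᵥ γ) σ s (x, z)).2.ofLp := by
  ext i
  have h1 : ∀ u : Fin p → ℝ, (designMatrix x *ᵥ u) i = u ⬝ᵥ (x i).ofLp :=
    fun u => dotProduct_comm _ _
  rw [← Matrix.mulVec_mulVec]
  simp only [response, sketchedSample, Pi.add_apply, Pi.smul_apply, smul_eq_mul, h1,
    sub_dotProduct]
  field_simp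
  ring

/-- Decomposition of the sketched `F`-statistic into chi-squared variables and a small term. -/
theorem exists_sketchedF_decomposition (hC : C.PosSemidef) (hx : IsGaussianDesign P x C)
    (hz : HasLaw z (multivariateGaussian 0 1) P) (hxz : IndepFun x z P) (β : Fin p → ℝ) {σ : ℝ}
    (hσ : 0 < σ) {S : Matrix (Fin p) (Fin k) ℝ} (hS : (Sᵀ * C * S).det ≠ 0) (hkn : k ≤ n) {D : ℝ}
    (hD : D = deltaSq C β S / (β ⬝ᵥ (C *ᵥ β) - deltaSq C β S + σ ^ 2)) :
    ∃ U V T M : Ω → ℝ,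
      HasLaw (fun ω => (U ω, V ω)) ((chiSquared k).prod (chiSquared (n - k))) P ∧
      HasLaw M (chiSquared n) P ∧
      (∀ δ, 0 < δ → P.real {ω | δ < |T ω|} ≤ n * D / δ ^ 2) ∧
      ∀ᵐ ω ∂P, sketchedF (designMatrix (x ω)) (response (x ω) β σ (z ω)) S =
        ((U ω + 2 * T ω + D * M ω) / k) / (V ω / (n - k : ℕ)) := by
  set γ := sketchedCoeff C β S with hγ
  have hres := quadratic_residual hC hS β
  rw [← hγ] at hres
  have hs20 : 0 < β ⬝ᵥ (C *ᵥ β) - deltaSq C β S + σ ^ 2 := by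
    have := deltaSq_le (S := S) hC β
    have := pow_pos hσ 2
    linarith
  -- `s²` is the effective noise variance, `σ²` plus the residual variance of the population
  -- regression, so `D` is the signal-to-noise ratio `Δ² / s²`.
  set s := √(β ⬝ᵥ (C *ᵥ β) - deltaSq C β S + σ ^ 2) with hs
  have hs0 : s ≠ 0 := (Real.sqrt_pos.2 hs20).ne'
  have hs2 : s ^ 2 = β ⬝ᵥ (C *ᵥ β) - deltaSq C β S + σ ^ 2 := Real.sq_sqrt hs20.le
  rw [← hs2] at hD
  have hG := (measurePreserving_sketchedSample (n := n) hC (transpose_mulVec_residual_eq_zero hS β)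
    hs0 (hs2.trans (by rw [← hres]))).hasLaw.comp (hx.hasLaw_prodMk hz hxz)
  obtain ⟨M, hM, hMN⟩ := exists_hasLaw_chiSquared_signal (n := n) hC S γ
  rw [← deltaSq_eq_quadratic hC hS] at hMN
  set G := sketchedSample S (β - S *ᵥ γ) σ s ∘ fun ω => (x ω, z ω) with hGdef
  refine ⟨fun ω => (G ω).2.ofLp ⬝ᵥ (hatMatrix (designMatrix (G ω).1) *ᵥ (G ω).2.ofLp),
    fun ω => (G ω).2.ofLp ⬝ᵥ (G ω).2.ofLp -
      (G ω).2.ofLp ⬝ᵥ (hatMatrix (designMatrix (G ω).1) *ᵥ (G ω).2.ofLp),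
    fun ω => s⁻¹ * ((G ω).2.ofLp ⬝ᵥ (designMatrix (G ω).1 *ᵥ γ)), fun ω => M (G ω),
    (hasLaw_hatMatrix_sketchedRow hC hS hkn).comp hG, hM.comp hG, fun δ hδ => ?_, ?_⟩
  · have h := measureReal_noise_signal_le (n := n) hC S γ (s := s) hδ
    rw [← deltaSq_eq_quadratic hC hS, ← hD] at h
    refine le_trans (le_of_eq ?_) h
    rw [← hG.map_eq, map_measureReal_apply_of_aemeasurable hG.aemeasurable]
    · rfl
    · exact measurableSet_noise_signal γ s δ
  · have h1 := ae_of_ae_map hG.aemeasurable (by rw [hG.map_eq]; exact hMN)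
    have h2 := ae_of_ae_map hG.aemeasurable (by
      rw [hG.map_eq]
      exact measurePreserving_fst.quasiMeasurePreserving.ae (ae_det_sketchedRow_ne_zero hC hS hkn))
    filter_upwards [h1, h2] with ω h1 h2
    have h3 : designMatrix (G ω).1 = designMatrix (x ω) * S := designMatrix_toLp_mulVec S (x ω)
    simp only [h3] at h1 h2 ⊢
    rw [response_eq S β γ σ hs0, sketchedF_eq _ _ h2 _ _ hs0, Nat.cast_sub hkn]
    rw [hD, h1]
    congr 2
    simp only [hGdef, Function.comp_apply]
    ring

end FiniteSample

end SketchedFTest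

/-! ### The limit for almost every sequence of sketches -/

theorem mainTheorem1
    -- noise level, test level, dimensions, coefficients and covariances (`n` is the sample size)
    (σ : ℝ) (hσ : 0 < σ) (α : ℝ) (hα : α ∈ Set.Ioo (0 : ℝ) 1)
    (p k : ℕ → ℕ)
    (β : (n : ℕ) → Fin (p n) → ℝ)
    (C : (n : ℕ) → Matrix (Fin (p n)) (Fin (p n)) ℝ) (hC : ∀ n, (C n).PosSemidef)
    -- Gaussian design with rows `N(0, C n)` and independent noise `N(0, I_n)`
    {Ω : ℕ → Type*} [∀ n, MeasurableSpace (Ω n)] (P : (n : ℕ) → Measure (Ω n))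
    [∀ n, IsProbabilityMeasure (P n)]
    (x : (n : ℕ) → Ω n → Fin n → EuclideanSpace ℝ (Fin (p n)))
    (z : (n : ℕ) → Ω n → EuclideanSpace ℝ (Fin n))
    (hx : ∀ n, SketchedFTest.IsGaussianDesign (P n) (x n) (C n))
    (hz : ∀ n, HasLaw (z n) (multivariateGaussian 0 1) (P n))
    (hxz : ∀ n, IndepFun (x n) (z n) (P n))
    -- local alternative and growth of the sketching dimension
    (hβ : Tendsto (fun n => β n ⬝ᵥ (C n *ᵥ β n)) atTop (𝓝 0))
    (ρ : ℝ) (hρ : ρ ∈ Set.Ioo (0 : ℝ) 1)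
    (hkn : Tendsto (fun n => (k n : ℝ) / n) atTop (𝓝 ρ))
    (hrank : ∀ᶠ n in atTop, k n < (C n).rank)
    -- the sequence of sketching matrices, on its own space, with any joint law across `n`
    {Ω' : Type*} [MeasurableSpace Ω'] (Q : Measure Ω') [IsProbabilityMeasure Q]
    (S : (n : ℕ) → Ω' → Matrix (Fin (p n)) (Fin (k n)) ℝ)
    (hS : ∀ n, SketchedFTest.IsGaussianSketch Q (S n)) :
    ∀ᵐ ω' ∂Q, Tendsto (fun n : ℕ =>
      SketchedFTest.sketchedPower (P n) (x n) (z n) (β n) σ α (S n ω') -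
        SketchedFTest.stdNormalCDF (-SketchedFTest.zQuantile α +
          √((1 - ρ) * n / (2 * ρ)) *
            (SketchedFTest.deltaSq (C n) (β n) (S n ω') / σ ^ 2)))
      atTop (𝓝 0) := by
  -- A countable intersection of almost sure events depends only on the marginal laws of the
  -- sketches, so their joint law across `n` is irrelevant. From here on the argument is
  -- deterministic in the sketches.
  have hdet : ∀ᵐ ω' ∂Q, ∀ n, k n < (C n).rank → ((S n ω')ᵀ * C n * S n ω').det ≠ 0 := by
    refine ae_all_iff.2 fun n => ?_
    by_cases h : k n < (C n).rank
    · filter_upwards [SketchedFTest.ae_det_sketch_ne_zero (hC n) h.le (hS n)] with ω' hω' _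
      exact hω'
    · exact ae_of_all _ fun _ h' => absurd h' h
  filter_upwards [hdet] with ω' hω'
  have hd0 : ∀ n, 0 ≤ SketchedFTest.deltaSq (C n) (β n) (S n ω') := fun n =>
    SketchedFTest.deltaSq_nonneg (hC n) _
  have hd1 : ∀ n, SketchedFTest.deltaSq (C n) (β n) (S n ω') ≤ β n ⬝ᵥ (C n *ᵥ β n) := fun n =>
    SketchedFTest.deltaSq_le (hC n) _
  set d : ℕ → ℝ := fun n => SketchedFTest.deltaSq (C n) (β n) (S n ω') with hd
  set b : ℕ → ℝ := fun n => β n ⬝ᵥ (C n *ᵥ β n) with hb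
  have hσ2 : 0 < σ ^ 2 := pow_pos hσ 2
  have hs : ∀ n, 0 < b n - d n + σ ^ 2 := fun n => by linarith [hd1 n]
  have hdt : Tendsto d atTop (𝓝 0) := squeeze_zero hd0 hd1 hβ
  have hst : Tendsto (fun n => b n - d n + σ ^ 2) atTop (𝓝 (σ ^ 2)) := by
    simpa using (hβ.sub hdt).add_const (σ ^ 2)
  have hD : Tendsto (fun n => d n / (b n - d n + σ ^ 2)) atTop (𝓝 0) := by
    have h := hdt.div hst hσ2.ne'
    rwa [zero_div] at h
  -- The ratio `s² / σ²` converts the exact drift parameter `D = Δ² / s²` into the stated `Δ² / σ²`;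
  -- it enters only as a relative error.
  have hκ : Tendsto (fun n => (b n - d n + σ ^ 2) / σ ^ 2) atTop (𝓝 1) := by
    have h := hst.div_const (σ ^ 2)
    rwa [div_self hσ2.ne'] at h
  have hgood : ∀ᶠ n in atTop, ((S n ω')ᵀ * C n * S n ω').det ≠ 0 ∧ k n ≤ n :=
    (hrank.mono fun n hn => hω' n hn).and
      ((SketchedFTest.eventually_lt_of_tendsto_div hρ hkn).mono fun n hn => le_of_lt hn)
  -- The conditional form makes the variables exist for every `n`, with value zero at the finitely
  -- many bad indices, so that whole sequences can be chosen.
  have hex : ∀ n, ∃ U V T M : Ω n → ℝ, ((S n ω')ᵀ * C n * S n ω').det ≠ 0 ∧ k n ≤ n →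
      HasLaw (fun ω => (U ω, V ω))
        ((SketchedFTest.chiSquared (k n)).prod (SketchedFTest.chiSquared (n - k n))) (P n) ∧
      HasLaw M (SketchedFTest.chiSquared n) (P n) ∧
      (∀ δ, 0 < δ → (P n).real {ω | δ < |T ω|} ≤
        n * (d n / (b n - d n + σ ^ 2)) / δ ^ 2) ∧
      ∀ᵐ ω ∂P n, SketchedFTest.sketchedF (SketchedFTest.designMatrix (x n ω))
        (SketchedFTest.response (x n ω) (β n) σ (z n ω)) (S n ω') =
        ((U ω + 2 * T ω + d n / (b n - d n + σ ^ 2) * M ω) / k n) / (V ω / (n - k n : ℕ)) := by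
    intro n
    by_cases h : ((S n ω')ᵀ * C n * S n ω').det ≠ 0 ∧ k n ≤ n
    · obtain ⟨U, V, T, M, hUVTM⟩ := SketchedFTest.exists_sketchedF_decomposition (hC n) (hx n)
        (hz n) (hxz n) (β n) hσ h.1 h.2 rfl
      exact ⟨U, V, T, M, fun _ => hUVTM⟩
    · exact ⟨0, 0, 0, 0, fun h' => absurd h' h⟩
  choose U V T M hUVTM using hex
  have key := SketchedFTest.tendsto_power_sub_gTail hα hρ hkn hD
    (hgood.mono fun n hn => (hUVTM n hn).1) (hgood.mono fun n hn => (hUVTM n hn).2.1)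
    (hgood.mono fun n hn => (hUVTM n hn).2.2.1) (hgood.mono fun n hn => (hUVTM n hn).2.2.2)
    (m := fun n => √((1 - ρ) * n / (2 * ρ)) * (d n / σ ^ 2))
    (fun n => mul_nonneg (Real.sqrt_nonneg _) (div_nonneg (hd0 n) hσ2.le))
    (Eventually.of_forall fun n => by
      have := (hs n).ne'
      field_simp) hκ
  refine key.congr fun n => ?_
  rw [← SketchedFTest.stdNormalCDF_neg, neg_sub', neg_add_eq_sub]
  simp only [SketchedFTest.sketchedPower, hd]
  ring_nf
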